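/- Let $n\ge 2$ and write $z=(z_1,z')\in\mathbb C\times\mathbb C^{n-1}$. Let $f:[0,\infty)\to[0,\infty)$ be continuous with $f(0)=0$, $f\not\equiv 0$, and $t\mapsto f(t)/t$ increasing (not necessarily strictly) on $(0,\infty)$; then every $\delta>0$ has exactly one preimage $f^{-1}(\delta)$. Let $D\subset\mathbb C^n$ be a bounded domain with $0\in\partial D$ which near $0$ is given by $\operatorname{Re}z_1+O(|\operatorname{Im}z_1|)<f(\|z'\|)$; that is, there is a real function $h$ with $h(z)=O(|\operatorname{Im}z_1|)$ as $z\to0$ such that, for $z$ in a neighbourhood of $0$, $z\in D$ if and only if $\operatorname{Re}z_1+h(z)<f(\|z'\|)$. For $z\in D$ and $X\in\mathbb C^n$ let $$S_D(z;X)=\sup_v\,[\mathcal L_v(z;X)]^{1/2},$$ where $\mathcal L_v(z;X)=\sum_{j,k}\frac{\partial^2 v}{\partial z_j\partial\bar z_k}(z)X_j\overline{X_k}$ is the Levi form and the supremum is over all $v:D\to[0,1)$ with $v(z)=0$, $\log v$ plurisubharmonic on $D$ (with $\log 0=-\infty$), and $v$ of class $\mathcal C^2$ near $z$ (Sibony metric);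 and let $$A_D(z;X)=\limsup_{\lambda\to0}\frac{\exp g_D(z,z+\lambda X)}{|\lambda|},$$ where $g_D(z,w)=\sup u(w)$, the supremum being over all plurisubharmonic $u:D\to[-\infty,0)$ such that, for some constant $C$, $u(\zeta)<\log\|\zeta-z\|+C$ for all $\zeta\in D\setminus\{z\}$ (Azukawa metric). Then there are constants $c>1$ and $\delta_0>0$ such that for all $\delta\in(0,\delta_0)$ the point $q_\delta:=(-\delta,0')$ belongs to $D$ and, for all $X\in\mathbb C^n$, $$c^{-1}B(\delta;X)\le S_D(q_\delta;X)\le A_D(q_\delta;X)\le c\,B(\delta;X),\qquad B(\delta;X):=\frac{f^{-1}(\delta)}{\delta}|X_1|+\|X\|.$$ -/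

import Mathlib

open Filter Topology MeasureTheory
open scoped NNReal ENNReal

noncomputable section

namespace InvariantMetrics

section PSH

variable {E : Type*} [NormedAddCommGroup E] [NormedSpace ℂ E]

/-- The mean value `(1 / 2π) ∫_0^{2π} u (z + r e^{iθ} X) dθ` of an extended real valued
function `u`, as the difference of the integrals of the positive and of the negative part.
For `u` upper semicontinuous and `< ⊤` the first integral is finite, so that the difference is
never of the form `⊤ - ⊤`. -/
def circleMean (u : E → EReal) (z X : E) (r : ℝ) : EReal :=
  (((2 * Real.pi)⁻¹ : ℝ) : EReal) *
    (((∫⁻ θ in Set.Ioc (0 : ℝ) (2 * Real.pi), (u (z + circleMap 0 r θ • X)).toENNReal : ℝ≥0∞) :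
        EReal) -
      ((∫⁻ θ in Set.Ioc (0 : ℝ) (2 * Real.pi), (-u (z + circleMap 0 r θ • X)).toENNReal : ℝ≥0∞) :
        EReal))

/-- `u : D → [-∞, ∞)` is plurisubharmonic on the open set `D`: it is upper semicontinuous, and
its restriction to every complex line satisfies the local submean value inequality.
The function `u = -∞` is allowed. Only the values of `u` on `D` matter. -/
structure IsPSHOn (u : E → EReal) (D : Set E) : Prop where
  lt_top : ∀ z ∈ D, u z < ⊤
  usc : UpperSemicontinuousOn u D
  submean : ∀ z ∈ D, ∀ X : E, ∀ᶠ r : ℝ in 𝓝[>] 0, u z ≤ circleMean u z X r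

/-- The family of competitors for the pluricomplex Green function of `D` with pole at `z`. At the
pole itself the inequality is to be read in the limit, since there `log ‖w - z‖ = -∞`. -/
structure IsGreenCompetitor (D : Set E) (z : E) (u : E → EReal) : Prop where
  psh : IsPSHOn u D
  neg : ∀ w ∈ D, u w < 0
  pole : ∃ C : ℝ, ∀ w ∈ D, w ≠ z → u w < ((Real.log ‖w - z‖ + C : ℝ) : EReal)

/-- The pluricomplex Green function `g_D(z, w)` of `D` with pole at `z`. -/
def greenFunction (D : Set E) (z w : E) : EReal :=
  ⨆ (u : E → EReal) (_ : IsGreenCompetitor D z u), u w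

/-- The Azukawa metric
`A_D(z; X) = limsup_{λ → 0, λ ≠ 0} exp (g_D(z, z + λ X)) / |λ|`. -/
def azukawaMetric (D : Set E) (z X : E) : ℝ≥0∞ :=
  limsup (fun l : ℂ => (greenFunction D z (z + l • X)).exp / ‖l‖ₑ) (𝓝[≠] (0 : ℂ))

/-- The Levi form `L_v(z; X) = ∑ ∂²v/∂z_j∂z̄_k (z) X_j X̄_k` of a real function `v` that is `C²`
near `z`. It is written as a quarter of the Laplacian at `0` of `λ ↦ v (z + λ X)`, that is,
`(D²v(z)(X, X) + D²v(z)(iX, iX)) / 4`. -/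
def leviForm (v : E → ℝ) (z X : E) : ℝ :=
  (iteratedFDeriv ℝ 2 v z ![X, X] +
    iteratedFDeriv ℝ 2 v z ![Complex.I • X, Complex.I • X]) / 4

/-- The competitors for the Sibony metric of `D` at `z`: functions `v : D → [0, 1)` with
`v z = 0`, of class `C²` near `z`, with `log v` plurisubharmonic on `D` (where `log 0 = -∞`). -/
structure IsSibonyCompetitor (D : Set E) (z : E) (v : E → ℝ) : Prop where
  nonneg : ∀ w ∈ D, 0 ≤ v w
  lt_one : ∀ w ∈ D, v w < 1
  map_base : v z = 0
  log_psh : IsPSHOn (fun w => ENNReal.log (ENNReal.ofReal (v w))) D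
  smooth : ContDiffAt ℝ 2 v z

/-- The Sibony metric `S_D(z; X) = sup_v L_v(z; X)^{1/2}`. -/
def sibonyMetric (D : Set E) (z X : E) : ℝ≥0∞ :=
  ⨆ (v : E → ℝ) (_ : IsSibonyCompetitor D z v), ENNReal.ofReal (Real.sqrt (leviForm v z X))

end PSH

/-- `z' = (z_2, …, z_n)` for `z = (z_1, z') ∈ ℂⁿ`, with `n = m + 1`. -/
def tail {m : ℕ} (z : EuclideanSpace ℂ (Fin (m + 1))) : EuclideanSpace ℂ (Fin m) :=
  WithLp.toLp 2 fun i => z i.succ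

/-- The point `q_δ = (-δ, 0')`. -/
def basePoint (m : ℕ) (δ : ℝ) : EuclideanSpace ℂ (Fin (m + 1)) :=
  EuclideanSpace.single 0 (-(δ : ℂ))

/-- For the profile functions `f` considered here, every `δ > 0` has exactly one preimage, so
that `Function.invFun f δ` is the value `f⁻¹(δ)` of the inverse function. -/
theorem existsUnique_preimage {f : ℝ≥0 → ℝ≥0} (hf : Continuous f) (hf0 : f 0 = 0)
    (hfne : f ≠ 0) (hmono : MonotoneOn (fun t => f t / t) (Set.Ioi 0)) {δ : ℝ≥0} (hδ : 0 < δ) :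
    ∃! t, f t = δ := by
  obtain ⟨a, ha⟩ : ∃ a, f a ≠ 0 := by
    by_contra h
    push Not at h
    exact hfne (funext h)
  have ha0 : 0 < a := by
    rcases eq_or_ne a 0 with h | h
    · exact absurd (h ▸ hf0) ha
    · exact pos_iff_ne_zero.mpr h
  have hfa : 0 < f a / a := div_pos (pos_iff_ne_zero.mpr ha) ha0
  set b := max a (δ / (f a / a)) with hb
  have hb0 : 0 < b := lt_of_lt_of_le ha0 (le_max_left _ _)
  have hδb : δ ≤ f b := by
    have h1 : f a / a ≤ f b / b := hmono ha0 hb0 (le_max_left _ _)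
    have h2 : δ ≤ b * (f a / a) := (div_le_iff₀ hfa).mp (le_max_right _ _)
    calc δ ≤ b * (f a / a) := h2
      _ ≤ b * (f b / b) := by gcongr
      _ = f b := mul_div_cancel₀ _ hb0.ne'
  obtain ⟨t, -, ht⟩ := intermediate_value_Icc (zero_le (a := b)) hf.continuousOn
    (show δ ∈ Set.Icc (f 0) (f b) from ⟨by rw [hf0]; exact zero_le, hδb⟩)
  have key : ∀ s t : ℝ≥0, f s = δ → f t = δ → t ≤ s := by
    intro s t hs ht
    by_contra! hst
    have hs0 : 0 < s := by
      rcases eq_or_ne s 0 with h | h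
      · rw [h, hf0] at hs
        exact absurd hs hδ.ne
      · exact pos_iff_ne_zero.mpr h
    have h := hmono hs0 (hs0.trans hst) hst.le
    simp only [hs, ht] at h
    exact absurd ((div_le_div_iff_of_pos_left hδ hs0 (hs0.trans hst)).mp h) (not_le.mpr hst)
  exact ⟨t, ht, fun s hs => le_antisymm (key t s ht hs) (key s t hs ht)⟩

/-- `B(δ; X) = (f⁻¹(δ) / δ) |X_1| + ‖X‖`. -/
def modelB {m : ℕ} (f : ℝ≥0 → ℝ≥0) (δ : ℝ) (X : EuclideanSpace ℂ (Fin (m + 1))) : ℝ :=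
  ((Function.invFun f δ.toNNReal : ℝ≥0) : ℝ) / δ * ‖X 0‖ + ‖X‖

end InvariantMetrics

end

/-! Write `T` for the preimage of `δ` and `q` for the base point. The middle inequality holds
because `log √v` is a competitor for the Green function whenever `v` is one for the Sibony metric;
the Levi form is recovered from the values of `v` along `X` and `iX`
(`sibonyMetric_le_azukawaMetric`).

Upper bound. Since `f(x)/x` increases, `f(x) ≥ (δ/T) x` for `x ≥ T`, while for `x < T` the margin
`δ` suffices. Hence `D` contains linear discs through `q`, of size independent of `δ`, in every
direction `Y` with `|Y₁|` at most a fixed multiple of `(δ/T) ‖Y'‖`. A general `X` need not be such a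
direction, but `X + ζ e` is one for all `ζ` on a large circle, where `e` is a unit vector of the
`z'`-space; the maximum principle in `ζ` carries the bound to `ζ = 0` (`azukawaMetric_le_of_discs`,
`azukawaMetric_le_of_profile`).

Lower bound. The term `‖X‖` comes from boundedness of `D`, through a multiple of `‖w - q‖²`. For
`(T/δ) |X₁|` the function `(z₁ + δ)/(z₁ - 2δ)` vanishes at `q` with derivative of order `1/δ`. Its
pole can meet `D`, but there `‖z'‖` is at least about `T`. A function of `‖z'‖` that dominates
`‖z'‖²` for `‖z'‖ ≥ τ`, yet is negligible against it near `z' = 0`, therefore replaces the singular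
function near the pole and leaves it intact near `q` (`ofReal_le_sibonyMetric_basePoint`). Its
exponent `2 + 2 / log (1/τ)` keeps it bounded uniformly in `τ`.

Logarithmic plurisubharmonicity of the glued function is checked pointwise, by supporting it from
below with powers of moduli of holomorphic functions (`HasHolomorphicSupport`). -/

namespace InvariantMetrics

/-! ### Circle means, the comparison principle and holomorphic support functions -/

section Potential

open Metric Set InnerProductSpace

variable {E : Type*} [NormedAddCommGroup E] [NormedSpace ℂ E]

theorem circleMean_mono {u u' : E → EReal} {z X : E} {r : ℝ}
    (h : ∀ θ, u (z + circleMap 0 r θ • X) ≤ u' (z + circleMap 0 r θ • X)) :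
    circleMean u z X r ≤ circleMean u' z X r := by
  unfold circleMean
  refine mul_le_mul_of_nonneg_left (EReal.sub_le_sub ?_ ?_) ?_
  · exact EReal.coe_ennreal_le_coe_ennreal_iff.2
      (lintegral_mono fun θ => EReal.toENNReal_le_toENNReal (h θ))
  · exact EReal.coe_ennreal_le_coe_ennreal_iff.2
      (lintegral_mono fun θ => EReal.toENNReal_le_toENNReal (EReal.neg_le_neg_iff.2 (h θ)))
  · exact EReal.coe_nonneg.2 (by positivity)

theorem circleMean_coe {φ : E → ℝ} {z X : E} {r : ℝ}
    (hφ : Continuous fun θ => φ (z + circleMap 0 r θ • X)) :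
    circleMean (fun w => (φ w : EReal)) z X r =
      ((Real.circleAverage (fun l => φ (z + l • X)) 0 r : ℝ) : EReal) := by
  have hint : IntegrableOn (fun θ => φ (z + circleMap 0 r θ • X)) (Ioc 0 (2 * Real.pi)) :=
    (hφ.integrableOn_Icc).mono_set Ioc_subset_Icc_self
  have h1 : (∫⁻ θ in Ioc (0 : ℝ) (2 * Real.pi),
      ENNReal.ofReal (φ (z + circleMap 0 r θ • X))) ≠ ⊤ := hint.lintegral_lt_top.ne
  have h2 : (∫⁻ θ in Ioc (0 : ℝ) (2 * Real.pi),
      ENNReal.ofReal (-φ (z + circleMap 0 r θ • X))) ≠ ⊤ := hint.neg.lintegral_lt_top.ne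
  unfold circleMean
  simp only [← EReal.coe_neg, EReal.real_coe_toENNReal]
  rw [Real.circleAverage_def, intervalIntegral.integral_of_le (by positivity),
    integral_eq_lintegral_pos_part_sub_lintegral_neg_part hint, smul_eq_mul, EReal.coe_mul,
    EReal.coe_sub]
  congr 2
  · rw [← EReal.coe_ennreal_toReal h1]
  · rw [← EReal.coe_ennreal_toReal h2]

theorem circleMean_coe_of_harmonic {φ : E → ℝ} {z X : E} {r : ℝ} (hr : 0 ≤ r)
    (h : HarmonicOnNhd (fun l : ℂ => φ (z + l • X)) (closedBall 0 r)) :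
    circleMean (fun w => (φ w : EReal)) z X r = φ z := by
  have hc : ContinuousOn (fun l : ℂ => φ (z + l • X)) (closedBall 0 r) :=
    fun l hl => ((h l hl).1.continuousAt).continuousWithinAt
  rw [circleMean_coe, InnerProductSpace.HarmonicOnNhd.circleAverage_eq (by rwa [abs_of_nonneg hr])]
  · simp
  · exact hc.comp_continuous (continuous_circleMap 0 r)
      fun θ => circleMap_mem_closedBall 0 hr θ

theorem le_of_le_harmonic {u : E → EReal} {φ : E → ℝ} {z X : E} {r : ℝ} (hr : 0 ≤ r)
    (h : HarmonicOnNhd (fun l : ℂ => φ (z + l • X)) (closedBall 0 r))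
    (hu : u z ≤ circleMean u z X r)
    (hle : ∀ θ, u (z + circleMap 0 r θ • X) ≤ φ (z + circleMap 0 r θ • X)) :
    u z ≤ φ z :=
  hu.trans ((circleMean_mono hle).trans (circleMean_coe_of_harmonic hr h).le)

/-- The comparison principle: a function with the local submean value property which on the
boundary is dominated by a harmonic function is dominated by it everywhere. -/
theorem le_of_le_boundary {w : ℂ → EReal} {K V : Set ℂ} (hK : IsCompact K) (hV : IsOpen V)
    (hVK : V ⊆ K) (husc : UpperSemicontinuousOn w K) (htop : ∀ z ∈ K, w z < ⊤)
    (hsub : ∀ z ∈ V, ∀ᶠ r : ℝ in 𝓝[>] 0, w z ≤ circleMean w z 1 r) {φ : ℂ → ℝ}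
    (hφ : ContinuousOn φ K)
    (hharm : ∀ p ∈ V, ∀ᶠ l in 𝓝 (0 : ℂ), HarmonicAt (fun l => φ (p + l)) l)
    (hb : ∀ z ∈ K \ V, w z ≤ φ z) : ∀ z ∈ K, w z ≤ φ z := by
  by_contra! hcon
  obtain ⟨z₀, hz₀, hlt⟩ := hcon
  obtain ⟨R, hR⟩ := hK.isBounded.exists_norm_le
  have hreal : ∀ z ∈ K, w z ≠ ⊥ → ((w z).toReal : EReal) = w z := fun z hz h =>
    EReal.coe_toReal (htop z hz).ne h
  have hz₀r := hreal z₀ hz₀ (ne_bot_of_gt hlt)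
  set a := (w z₀).toReal with ha
  rw [← hz₀r, EReal.coe_lt_coe_iff] at hlt
  -- Small enough that adding `η ‖z‖²` cannot move the maximum of `w - φ` to the boundary; the `+ 1`
  -- covers `R = 0`.
  set η := (a - φ z₀) / (2 * (R ^ 2 + 1)) with hη
  have hη0 : 0 < η := div_pos (by linarith) (by positivity)
  have hηR : η * R ^ 2 < a - φ z₀ := by
    rw [hη, div_mul_eq_mul_div, div_lt_iff₀ (by positivity)]
    nlinarith [sq_nonneg R]
  have hFcont : ContinuousOn (fun z : ℂ => η * ‖z‖ ^ 2 - φ z) K := by fun_prop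
  obtain ⟨p, hp, hmax⟩ := (UpperSemicontinuousOn.add' (g := fun z =>
      ((η * ‖z‖ ^ 2 - φ z : ℝ) : EReal)) husc
      (continuous_coe_real_ereal.comp_continuousOn hFcont).upperSemicontinuousOn
      fun z _ => EReal.continuousAt_add (Or.inr (EReal.coe_ne_bot _))
        (Or.inr (EReal.coe_ne_top _))).exists_isMaxOn ⟨z₀, hz₀⟩ hK
  have hmax' : ∀ z ∈ K, w z + ((η * ‖z‖ ^ 2 - φ z : ℝ) : EReal) ≤
      w p + ((η * ‖p‖ ^ 2 - φ p : ℝ) : EReal) := fun z hz => hmax hz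
  have hpb : w p ≠ ⊥ := by
    intro h
    have := hmax' z₀ hz₀
    rw [h, EReal.bot_add, ← hz₀r, ← EReal.coe_add, le_bot_iff] at this
    exact EReal.coe_ne_bot _ this
  have hpr := hreal p hp hpb
  set b := (w p).toReal with hbdef
  have h1 : a + (η * ‖z₀‖ ^ 2 - φ z₀) ≤ b + (η * ‖p‖ ^ 2 - φ p) := by
    have := hmax' z₀ hz₀
    rw [← hz₀r, ← hpr] at this
    exact_mod_cast this
  have hpR : ‖p‖ ^ 2 ≤ R ^ 2 := pow_le_pow_left₀ (norm_nonneg _) (hR p hp) 2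
  have h2 : η * ‖p‖ ^ 2 ≤ η * R ^ 2 := mul_le_mul_of_nonneg_left hpR hη0.le
  have h3 : 0 ≤ η * ‖z₀‖ ^ 2 := by positivity
  have hpV : p ∈ V := by
    by_contra hpV
    have := hb p ⟨hp, hpV⟩
    rw [← hpr, EReal.coe_le_coe_iff] at this
    linarith
  have hle : ∀ z ∈ K, w z ≤ ((b + η * ‖p‖ ^ 2 - φ p + φ z - η * ‖z‖ ^ 2 : ℝ) : EReal) := by
    intro z hz
    by_cases hzb : w z = ⊥
    · rw [hzb]; exact bot_le
    have := hmax' z hz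
    rw [← hreal z hz hzb, ← hpr] at this
    rw [← hreal z hz hzb, EReal.coe_le_coe_iff]
    have h4 : (w z).toReal + (η * ‖z‖ ^ 2 - φ z) ≤ b + (η * ‖p‖ ^ 2 - φ p) := by
      exact_mod_cast this
    linarith
  obtain ⟨s, hs, hsV⟩ := Metric.nhds_basis_closedBall.mem_iff.1 (hV.mem_nhds hpV)
  obtain ⟨s', hs', hsh⟩ := Metric.nhds_basis_closedBall.eventually_iff.1 (hharm p hpV)
  obtain ⟨r, ⟨hr, hr0⟩, hrs⟩ := ((hsub p hpV).and self_mem_nhdsWithin).and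
    (Filter.mem_of_superset (Ioo_mem_nhdsGT (lt_min hs hs')) fun r hr => hr.2) |>.exists
  have hr0 : (0 : ℝ) < r := hr0
  have hrs : r < min s s' := hrs
  -- On the circle of radius `r` about `p`, `‖z‖² = ‖p‖² + r² + 2 Re (p̄ (z - p))`, so the majorant
  -- from maximality agrees there with the harmonic `ψ`. The submean inequality then gives `w p ≤ ψ
  -- p = w p - η r²`, a contradiction.
  let ψ : ℂ → ℝ := fun z => φ z + ((b + η * ‖p‖ ^ 2 - φ p - η * (‖p‖ ^ 2 + r ^ 2)) +
    (-(2 * η)) * (starRingEnd ℂ p * (z - p)).re)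
  have key : w p ≤ ψ p := by
    refine le_of_le_harmonic (X := 1) hr0.le ?_ hr ?_
    · intro l hl
      have h5 := hsh (closedBall_subset_closedBall (hrs.le.trans (min_le_right _ _)) hl)
      have h6 : HarmonicAt (fun l : ℂ => (b + η * ‖p‖ ^ 2 - φ p - η * (‖p‖ ^ 2 + r ^ 2)) +
          (-(2 * η)) * (starRingEnd ℂ p * l).re) l := by
        have h7 : AnalyticAt ℂ (fun l : ℂ => ((b + η * ‖p‖ ^ 2 - φ p -
            η * (‖p‖ ^ 2 + r ^ 2) : ℝ) : ℂ) + ((-(2 * η) : ℝ) : ℂ) * (starRingEnd ℂ p * l)) l := by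
          fun_prop
        convert h7.harmonicAt_re using 2 with l
        rw [Complex.add_re, Complex.ofReal_re, Complex.re_ofReal_mul]
      convert h5.add h6 using 2 with l
      simp [ψ]
    · intro θ
      have hmem : p + circleMap 0 r θ • (1 : ℂ) ∈ K := by
        apply hVK; apply hsV
        simp [mem_closedBall, abs_of_pos hr0]
        exact hrs.le.trans (min_le_left _ _)
      refine (hle _ hmem).trans (EReal.coe_le_coe_iff.2 (le_of_eq ?_))
      have h8 : ‖p + circleMap 0 r θ • (1 : ℂ)‖ ^ 2 = ‖p‖ ^ 2 + r ^ 2 +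
          2 * (starRingEnd ℂ p * circleMap 0 r θ).re := by
        have h9 : ‖circleMap 0 r θ‖ ^ 2 = r ^ 2 := by simp
        rw [← h9, smul_eq_mul, mul_one, ← Complex.normSq_eq_norm_sq, ← Complex.normSq_eq_norm_sq,
          ← Complex.normSq_eq_norm_sq]
        simp only [Complex.normSq_apply, Complex.add_re, Complex.add_im, Complex.mul_re,
          Complex.conj_re, Complex.conj_im]
        ring
      simp only [ψ, h8]
      simp only [smul_eq_mul, mul_one, add_sub_cancel_left]
      ring
  rw [← hpr, EReal.coe_le_coe_iff] at key
  simp only [ψ, sub_self, mul_zero, Complex.zero_re] at key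
  nlinarith [mul_pos hη0 (pow_pos hr0 2)]

theorem IsPSHOn.comp_line {u : E → EReal} {D : Set E} (hu : IsPSHOn u D) (a Y : E) :
    IsPSHOn (fun l : ℂ => u (a + l • Y)) {l | a + l • Y ∈ D} where
  lt_top l hl := hu.lt_top _ hl
  usc := hu.usc.comp (Continuous.continuousOn (by fun_prop)) fun l hl => hl
  submean l hl X := by
    filter_upwards [hu.submean _ hl (X • Y)] with r hr
    simpa only [circleMean, add_smul, smul_assoc, add_assoc] using hr

/-- `v` is supported at `z` from below by a function `c * ‖g‖ ^ p` with `g` holomorphic and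
nonvanishing near `z`, with equality at `z`. -/
def HasHolomorphicSupport (v : E → ℝ) (z : E) : Prop :=
  ∃ (g : E → ℂ) (p c : ℝ), g z ≠ 0 ∧ (∀ᶠ w in 𝓝 z, DifferentiableAt ℂ g w) ∧
    c * ‖g z‖ ^ p = v z ∧ ∀ᶠ w in 𝓝 z, c * ‖g w‖ ^ p ≤ v w

theorem HasHolomorphicSupport.mono {v v' : E → ℝ} {z : E} (h : HasHolomorphicSupport v z)
    (heq : v z = v' z) (hle : ∀ᶠ w in 𝓝 z, v w ≤ v' w) : HasHolomorphicSupport v' z := by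
  obtain ⟨g, p, c, h1, h2, h3, h4⟩ := h
  exact ⟨g, p, c, h1, h2, h3.trans heq, by
    filter_upwards [h4, hle] with w hw hw' using hw.trans hw'⟩

theorem HasHolomorphicSupport.const_mul {v : E → ℝ} {z : E} (h : HasHolomorphicSupport v z)
    {a : ℝ} (ha : 0 ≤ a) : HasHolomorphicSupport (fun w => a * v w) z := by
  obtain ⟨g, p, c, h1, h2, h3, h4⟩ := h
  refine ⟨g, p, a * c, h1, h2, by rw [mul_assoc, h3], h4.mono fun w hw => ?_⟩
  rw [mul_assoc]
  exact mul_le_mul_of_nonneg_left hw ha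

theorem HasHolomorphicSupport.rpow {v : E → ℝ} {z : E} (h : HasHolomorphicSupport v z)
    (hv : 0 < v z) {a : ℝ} (ha : 0 ≤ a) : HasHolomorphicSupport (fun w => v w ^ a) z := by
  obtain ⟨g, p, c, h1, h2, h3, h4⟩ := h
  have hc : 0 ≤ c := by
    by_contra! hc
    have : c * ‖g z‖ ^ p ≤ 0 := mul_nonpos_of_nonpos_of_nonneg hc.le (by positivity)
    linarith
  refine ⟨g, p * a, c ^ a, h1, h2, ?_, h4.mono fun w hw => ?_⟩
  · rw [Real.rpow_mul (norm_nonneg _), ← Real.mul_rpow hc (by positivity), h3]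
  · rw [Real.rpow_mul (norm_nonneg _), ← Real.mul_rpow hc (by positivity)]
    exact Real.rpow_le_rpow (by positivity) hw ha

theorem HasHolomorphicSupport.max {v v' : E → ℝ} {z : E}
    (h : 0 < v z → HasHolomorphicSupport v z) (h' : 0 < v' z → HasHolomorphicSupport v' z)
    (hpos : 0 < max (v z) (v' z)) : HasHolomorphicSupport (fun w => max (v w) (v' w)) z := by
  rcases le_total (v z) (v' z) with hle | hle
  · rw [max_eq_right hle] at hpos
    exact (h' hpos).mono (max_eq_right hle).symm (Eventually.of_forall fun w => le_max_right _ _)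
  · rw [max_eq_left hle] at hpos
    exact (h hpos).mono (max_eq_left hle).symm (Eventually.of_forall fun w => le_max_left _ _)

/-- Cauchy–Schwarz: pairing `G w` with the fixed vector `G z` is holomorphic in `w`, and the bound
is an equality at `w = z`. -/
theorem hasHolomorphicSupport_norm_sq {H : Type*} [NormedAddCommGroup H] [InnerProductSpace ℂ H]
    {G : E → H} {z : E} (hG : ∀ᶠ w in 𝓝 z, DifferentiableAt ℂ G w) (hz : G z ≠ 0) :
    HasHolomorphicSupport (fun w => ‖G w‖ ^ 2) z := by
  have hn : 0 < ‖G z‖ := norm_pos_iff.2 hz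
  refine ⟨fun w => innerSL ℂ (G z) (G w), 2, (‖G z‖ ^ 2)⁻¹, ?_, ?_, ?_,
    Eventually.of_forall fun w => ?_⟩
  · simpa using hz
  · exact hG.mono fun w hw => (innerSL ℂ (G z)).differentiableAt.comp w hw
  · have : ‖innerSL ℂ (G z) (G z)‖ = ‖G z‖ ^ 2 := by
      rw [innerSL_apply_apply, inner_self_eq_norm_sq_to_K]; simp
    rw [this, Real.rpow_two]
    field_simp
  · have : ‖innerSL ℂ (G z) (G w)‖ ≤ ‖G z‖ * ‖G w‖ := norm_inner_le_norm _ _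
    rw [Real.rpow_two, inv_mul_le_iff₀ (by positivity), ← mul_pow]
    gcongr

/-- The logarithm of the support function is harmonic on complex lines, lies below `log v` and
touches it at the centre, so its mean value property yields the submean inequality. Zeros of `v` are
trivial, the value there being `⊥`. -/
theorem isPSHOn_log_of_hasHolomorphicSupport {v : E → ℝ} {D : Set E} (hv : ContinuousOn v D)
    (hsupp : ∀ z ∈ D, 0 < v z → HasHolomorphicSupport v z) :
    IsPSHOn (fun w => ENNReal.log (ENNReal.ofReal (v w))) D where
  lt_top z _ := ENNReal.log_lt_top_iff.2 ENNReal.ofReal_lt_top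
  usc := (ENNReal.continuous_log.comp_continuousOn
    (ENNReal.continuous_ofReal.comp_continuousOn hv)).upperSemicontinuousOn
  submean z hz X := by
    rcases le_or_gt (v z) 0 with hvz | hvz
    · exact Eventually.of_forall fun r => by simp [ENNReal.ofReal_of_nonpos hvz]
    obtain ⟨g, p, c, hgz, hg, hgv, hgle⟩ := hsupp z hz hvz
    have hc : 0 < c := by
      by_contra! hc
      have : c * ‖g z‖ ^ p ≤ 0 := mul_nonpos_of_nonpos_of_nonneg hc (by positivity)
      linarith
    have hne : ∀ᶠ w in 𝓝 z, g w ≠ 0 :=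
      hg.self_of_nhds.continuousAt.eventually_ne hgz
    have hcont : Tendsto (fun l : ℂ => z + l • X) (𝓝 0) (𝓝 z) := by
      have : Continuous fun l : ℂ => z + l • X := by fun_prop
      simpa using this.tendsto 0
    obtain ⟨s, hs, hball⟩ := Metric.nhds_basis_ball.eventually_iff.1
      (hcont.eventually (hg.and (hne.and hgle)))
    filter_upwards [Ioo_mem_nhdsGT hs] with r hr
    have hsub : closedBall (0 : ℂ) r ⊆ ball 0 s := closedBall_subset_ball hr.2
    have hlog : ∀ w, g w ≠ 0 → Real.log (c * ‖g w‖ ^ p) = Real.log c + p * Real.log ‖g w‖ := by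
      intro w hw
      have : 0 < ‖g w‖ := norm_pos_iff.2 hw
      rw [Real.log_mul hc.ne' (by positivity), Real.log_rpow this]
    have hpos : ∀ w, g w ≠ 0 → 0 < c * ‖g w‖ ^ p := fun w hw => by
      have : 0 < ‖g w‖ := norm_pos_iff.2 hw
      positivity
    have hz' : ENNReal.log (ENNReal.ofReal (v z)) =
        ((Real.log c + p * Real.log ‖g z‖ : ℝ) : EReal) := by
      rw [← hlog z hgz, hgv, ENNReal.log_ofReal_of_pos hvz]
    have hmean := circleMean_coe_of_harmonic (z := z) (X := X)
      (φ := fun w => Real.log c + p * Real.log ‖g w‖) hr.1.le ?_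
    · rw [hz', ← hmean]
      refine circleMean_mono fun θ => ?_
      obtain ⟨-, h1, h2⟩ := hball (hsub (circleMap_mem_closedBall 0 hr.1.le θ))
      rw [← hlog _ h1, ← ENNReal.log_ofReal_of_pos (hpos _ h1)]
      exact ENNReal.log_monotone (ENNReal.ofReal_le_ofReal h2)
    · intro l hl
      have hd : DifferentiableOn ℂ (fun l : ℂ => g (z + l • X)) (ball 0 s) := fun l hl =>
        ((hball hl).1.comp l (by fun_prop)).differentiableWithinAt
      have hlog' := (hd.analyticAt (isOpen_ball.mem_nhds (hsub hl))).harmonicAt_log_norm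
        (hball (hsub hl)).2.1
      exact (harmonicAt_const _).add (hlog'.const_smul (c := p))

end Potential

/-! ### The Sibony metric is at most the Azukawa metric -/

section SibonyLeAzukawa

open Metric Set Asymptotics

variable {E : Type*} [NormedAddCommGroup E] [NormedSpace ℂ E]

theorem IsPSHOn.const_mul {u : E → EReal} {D : Set E} (hu : IsPSHOn u D) {c : ℝ} (hc : 0 < c) :
    IsPSHOn (fun w => (c : EReal) * u w) D where
  lt_top z hz := by
    have h := hu.lt_top z hz
    induction hx : u z with
    | bot => rw [EReal.coe_mul_bot_of_pos hc]; exact bot_lt_top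
    | coe x => rw [← EReal.coe_mul]; exact EReal.coe_lt_top _
    | top => exact absurd hx h.ne
  usc := (continuous_iff_continuousAt.2 fun x => EReal.Tendsto.const_mul
    tendsto_id (by simp) (by simp) : Continuous fun x : EReal => (c : EReal) * x).comp_upperSemicontinuousOn
    hu.usc
    fun a b hab => mul_le_mul_of_nonneg_left hab (EReal.coe_nonneg.2 hc.le)
  submean z hz X := by
    filter_upwards [hu.submean z hz X] with r hr
    have hc' : (0 : EReal) ≤ c := EReal.coe_nonneg.2 hc.le
    refine (mul_le_mul_of_nonneg_left hr hc').trans (le_of_eq ?_)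
    unfold circleMean
    simp only [← _root_.mul_neg, EReal.toENNReal_mul hc', EReal.real_coe_toENNReal]
    rw [lintegral_const_mul' _ _ ENNReal.ofReal_ne_top,
      lintegral_const_mul' _ _ ENNReal.ofReal_ne_top, EReal.coe_ennreal_mul,
      EReal.coe_ennreal_mul, EReal.coe_ennreal_ofReal, max_eq_left hc.le,
      mul_left_comm, EReal.mul_sub_of_nonneg_of_ne_top hc' (EReal.coe_ne_top c)]

theorem exists_le_mul_norm_sub_sq {v : E → ℝ} {z : E} (hv : ContDiffAt ℝ 2 v z) (hz : v z = 0)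
    (hnn : ∀ᶠ w in 𝓝 z, 0 ≤ v w) :
    ∃ K : ℝ, ∀ᶠ w in 𝓝 z, v w ≤ K * ‖w - z‖ ^ 2 := by
  have hmin : IsLocalMin v z := by
    filter_upwards [hnn] with w hw
    rwa [hz]
  have hd2 : DifferentiableAt ℝ (fderiv ℝ v) z :=
    (hv.fderiv_right (m := 1) le_rfl).differentiableAt one_ne_zero
  obtain ⟨K, hK⟩ := hd2.isBigO_sub.bound
  rw [hmin.fderiv_eq_zero] at hK
  have hd : ∀ᶠ w in 𝓝 z, DifferentiableAt ℝ v w :=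
    (hv.eventually (by simp)).mono fun w hw => hw.differentiableAt two_ne_zero
  obtain ⟨s, hs, hball⟩ := Metric.nhds_basis_ball.eventually_iff.1 (hK.and hd)
  refine ⟨|K|, ?_⟩
  filter_upwards [ball_mem_nhds z hs] with w hw
  have hsub : closedBall z ‖w - z‖ ⊆ ball z s := closedBall_subset_ball (by
    simpa [dist_eq_norm] using hw)
  have := (convex_closedBall z ‖w - z‖).norm_image_sub_le_of_norm_fderiv_le (𝕜 := ℝ)
    (f := v) (C := |K| * ‖w - z‖) (x := z) (y := w) (fun x hx => (hball (hsub hx)).2)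
    (fun x hx => by
      refine (by simpa using (hball (hsub hx)).1 : ‖fderiv ℝ v x‖ ≤ K * ‖x - z‖).trans ?_
      refine mul_le_mul (le_abs_self K) ?_ (norm_nonneg _) (abs_nonneg _)
      simpa [dist_eq_norm] using hx)
    (by simp) (by simp [dist_eq_norm])
  rw [hz, sub_zero, Real.norm_eq_abs] at this
  calc v w ≤ |v w| := le_abs_self _
    _ ≤ _ := this
    _ = _ := by ring

/-- The point `z` is a local minimum, so the first derivative vanishes, and one use of L'Hôpital's
rule leaves a difference quotient of `fderiv ℝ v`. -/
theorem tendsto_div_sq {v : E → ℝ} {z : E} (hv : ContDiffAt ℝ 2 v z) (hz : v z = 0)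
    (hnn : ∀ᶠ w in 𝓝 z, 0 ≤ v w) (X : E) :
    Tendsto (fun r : ℝ => v (z + r • X) / r ^ 2) (𝓝[>] 0)
      (𝓝 (iteratedFDeriv ℝ 2 v z ![X, X] / 2)) := by
  have hmin : IsLocalMin v z := by
    filter_upwards [hnn] with w hw
    rwa [hz]
  have hd2 : DifferentiableAt ℝ (fderiv ℝ v) z :=
    (hv.fderiv_right (m := 1) le_rfl).differentiableAt one_ne_zero
  have hd : ∀ᶠ w in 𝓝 z, DifferentiableAt ℝ v w :=
    (hv.eventually (by simp)).mono fun w hw => hw.differentiableAt two_ne_zero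
  have hline : ∀ r : ℝ, HasDerivAt (fun r : ℝ => z + r • X) X r := fun r => by
    simpa using ((hasDerivAt_id r).smul_const X).const_add z
  have hcont : Tendsto (fun r : ℝ => z + r • X) (𝓝[>] 0) (𝓝 z) := by
    have := (hline 0).continuousAt.tendsto
    simp only [zero_smul, add_zero] at this
    exact this.mono_left nhdsWithin_le_nhds
  have hderiv : HasDerivAt (fun r : ℝ => fderiv ℝ v (z + r • X) X)
      (fderiv ℝ (fderiv ℝ v) z X X) 0 := by
    have h1 : HasFDerivAt (fderiv ℝ v) (fderiv ℝ (fderiv ℝ v) z) (z + (0 : ℝ) • X) := by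
      simpa using hd2.hasFDerivAt
    have h2 := h1.comp_hasDerivAt (0 : ℝ) (hline 0)
    simpa using h2.clm_apply (hasDerivAt_const (0 : ℝ) X)
  have hslope := hderiv.tendsto_slope_zero_right
  simp only [zero_add, zero_smul, add_zero, hmin.fderiv_eq_zero, _root_.zero_apply,
    sub_zero, smul_eq_mul] at hslope
  rw [iteratedFDeriv_two_apply]
  simp only [Matrix.cons_val_zero, Matrix.cons_val_one]
  refine HasDerivAt.lhopital_zero_nhdsGT (f' := fun r => fderiv ℝ v (z + r • X) X)
    (g' := fun r => 2 * r) ?_ ?_ ?_ ?_ ?_ ?_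
  · filter_upwards [hcont.eventually hd] with r hr
    exact hr.hasFDerivAt.comp_hasDerivAt r (hline r)
  · exact Eventually.of_forall fun r => by simpa using hasDerivAt_pow 2 r
  · filter_upwards [self_mem_nhdsWithin] with r hr
    have : (0 : ℝ) < r := hr
    positivity
  · simpa [hz, Function.comp_def] using hv.continuousAt.tendsto.comp hcont
  · have : Tendsto (fun r : ℝ => r ^ 2) (𝓝 0) (𝓝 0) := by
      simpa using (continuous_pow 2).tendsto (0 : ℝ)
    exact this.mono_left nhdsWithin_le_nhds
  · refine (hslope.div_const 2).congr fun r => ?_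
    rw [div_eq_mul_inv, div_eq_mul_inv, mul_inv]
    ring

theorem tendsto_leviForm {v : E → ℝ} {z : E} (hv : ContDiffAt ℝ 2 v z) (hz : v z = 0)
    (hnn : ∀ᶠ w in 𝓝 z, 0 ≤ v w) (X : E) :
    Tendsto (fun r : ℝ => (v (z + (r : ℂ) • X) + v (z + (r * Complex.I : ℂ) • X)) / (2 * r ^ 2))
      (𝓝[>] 0) (𝓝 (leviForm v z X)) := by
  have h := ((tendsto_div_sq hv hz hnn X).add (tendsto_div_sq hv hz hnn (Complex.I • X))).div_const 2
  convert h using 2 with r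
  · simp only [mul_smul, Complex.coe_smul]
    rw [← add_div, div_div, mul_comm]
  · rw [leviForm]; ring

theorem IsSibonyCompetitor.isGreenCompetitor {D : Set E} {z : E} {v : E → ℝ} (hD : IsOpen D)
    (hz : z ∈ D) (hv : IsSibonyCompetitor D z v) :
    IsGreenCompetitor D z fun w => ENNReal.log (ENNReal.ofReal (Real.sqrt (v w))) where
  psh := by
    have hnonneg : ∀ w, Real.sqrt (v w) = max (v w) 0 ^ (1 / 2 : ℝ) := fun w => by
      rw [← Real.sqrt_eq_rpow]
      rcases le_total (v w) 0 with h | h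
      · rw [max_eq_right h, Real.sqrt_eq_zero_of_nonpos h, Real.sqrt_zero]
      · rw [max_eq_left h]
    convert hv.log_psh.const_mul (c := 1 / 2) (by norm_num) using 2 with w
    rw [← ENNReal.log_rpow, hnonneg, ← ENNReal.ofReal_rpow_of_nonneg (le_max_right _ _)
      (by norm_num), ENNReal.ofReal_max]
    simp
  neg w hw := by
    rw [ENNReal.log_lt_zero_iff, ENNReal.ofReal_lt_one, Real.sqrt_lt' one_pos, one_pow]
    exact hv.lt_one w hw
  pole := by
    have hnn : ∀ᶠ w in 𝓝 z, 0 ≤ v w :=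
      (hD.eventually_mem hz).mono fun w hw => hv.nonneg w hw
    obtain ⟨K, hK⟩ := exists_le_mul_norm_sub_sq hv.smooth hv.map_base hnn
    obtain ⟨s, hs, hball⟩ := Metric.nhds_basis_ball.eventually_iff.1 hK
    -- `√|K|` serves inside the ball of radius `s`; `s⁻¹` serves outside, where `√v < 1 ≤ ‖w - z‖ /
    -- s`; the `1` makes the inequality strict.
    set M := Real.sqrt |K| + s⁻¹ + 1 with hM
    have hM0 : 0 < M := by positivity
    refine ⟨Real.log M, fun w hw hwz => ?_⟩
    have hn : 0 < ‖w - z‖ := norm_pos_iff.2 (sub_ne_zero.2 hwz)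
    rw [← Real.log_mul hn.ne' hM0.ne', ← ENNReal.log_ofReal_of_pos (by positivity),
      ENNReal.log_lt_log_iff, ENNReal.ofReal_lt_ofReal_iff (by positivity)]
    by_cases hws : w ∈ ball z s
    · have h1 : Real.sqrt (v w) ≤ Real.sqrt |K| * ‖w - z‖ := by
        rw [← Real.sqrt_sq hn.le, ← Real.sqrt_mul (abs_nonneg K)]
        exact Real.sqrt_le_sqrt ((hball hws).trans (by gcongr; exact le_abs_self K))
      have : 0 < s⁻¹ := inv_pos.2 hs
      nlinarith
    · have h1 : Real.sqrt (v w) < 1 := by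
        rw [Real.sqrt_lt' one_pos, one_pow]; exact hv.lt_one w hw
      have h2 : s ≤ ‖w - z‖ := by simpa [dist_eq_norm] using hws
      have h3 : 1 ≤ ‖w - z‖ * s⁻¹ := by
        rw [← div_eq_mul_inv, one_le_div hs]; exact h2
      have := Real.sqrt_nonneg |K|
      nlinarith

theorem sibonyMetric_le_azukawaMetric {D : Set E} {z : E} (hD : IsOpen D) (hz : z ∈ D) (X : E) :
    sibonyMetric D z X ≤ azukawaMetric D z X := by
  refine iSup₂_le fun v hv => ?_
  have hnn : ∀ᶠ w in 𝓝 z, 0 ≤ v w :=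
    (hD.eventually_mem hz).mono fun w hw => hv.nonneg w hw
  have hlim := tendsto_leviForm hv.smooth hv.map_base hnn X
  refine le_of_forall_lt fun a ha => ?_
  obtain ⟨b, hab, hb⟩ := exists_between ha
  have hbtop : b ≠ ⊤ := ne_top_of_lt hb
  lift b to ℝ≥0 using hbtop
  have hbL : (b : ℝ) ^ 2 < leviForm v z X := by
    have h1 : (b : ℝ) < Real.sqrt (leviForm v z X) := by
      rwa [← ENNReal.ofReal_coe_nnreal, ENNReal.ofReal_lt_ofReal_iff_of_nonneg b.coe_nonneg] at hb
    exact (Real.lt_sqrt b.coe_nonneg).1 h1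
  refine hab.trans_le (le_limsup_of_frequently_le ?_ (by isBoundedDefault))
  -- The Levi form is the limit of the average of `v / r²` at `l = r` and `l = i r`, so for each
  -- small `r` one of the two exceeds `b²`. A limsup needs no more than this.
  have hsuff : ∃ᶠ l : ℂ in 𝓝[≠] 0, (b : ℝ) ^ 2 * ‖l‖ ^ 2 ≤ v (z + l • X) := by
    intro hcon
    have ht1 : Tendsto (fun r : ℝ => (r : ℂ)) (𝓝[>] 0) (𝓝[≠] 0) := by
      refine tendsto_nhdsWithin_iff.2 ⟨?_, ?_⟩
      · exact (by simpa using Complex.continuous_ofReal.tendsto (0 : ℝ) :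
          Tendsto (fun r : ℝ => (r : ℂ)) (𝓝 0) (𝓝 0)).mono_left nhdsWithin_le_nhds
      · filter_upwards [self_mem_nhdsWithin] with r hr
        simpa using (ne_of_gt hr)
    have ht2 : Tendsto (fun r : ℝ => (r * Complex.I : ℂ)) (𝓝[>] 0) (𝓝[≠] 0) := by
      refine tendsto_nhdsWithin_iff.2 ⟨?_, ?_⟩
      · have : Continuous fun r : ℝ => (r * Complex.I : ℂ) := by fun_prop
        exact (by simpa using this.tendsto (0 : ℝ) :
          Tendsto (fun r : ℝ => (r * Complex.I : ℂ)) (𝓝 0) (𝓝 0)).mono_left nhdsWithin_le_nhds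
      · filter_upwards [self_mem_nhdsWithin] with r hr
        simpa using (ne_of_gt hr)
    obtain ⟨r, ⟨⟨h1, h2⟩, h3⟩, h4⟩ := (((ht1.eventually hcon).and (ht2.eventually hcon)).and
      (hlim.eventually (lt_mem_nhds hbL))).and self_mem_nhdsWithin |>.exists
    have hr : (0 : ℝ) < r := h4
    rw [lt_div_iff₀ (by positivity)] at h3
    simp only [not_le, norm_mul, Complex.norm_real, Complex.norm_I, mul_one,
      Real.norm_eq_abs, sq_abs] at h1 h2
    linarith
  have hDl : ∀ᶠ l : ℂ in 𝓝[≠] 0, l ≠ 0 := self_mem_nhdsWithin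
  refine (hsuff.and_eventually hDl).mono fun l ⟨hl, hl0⟩ => ?_
  have hl0' : 0 < ‖l‖ := norm_pos_iff.2 hl0
  have hgreen : ENNReal.log (ENNReal.ofReal (Real.sqrt (v (z + l • X)))) ≤
      greenFunction D z (z + l • X) :=
    le_iSup₂ (f := fun (u : E → EReal) (_ : IsGreenCompetitor D z u) => u (z + l • X)) _
      (hv.isGreenCompetitor hD hz)
  have hexp : ENNReal.ofReal (Real.sqrt (v (z + l • X))) ≤
      (greenFunction D z (z + l • X)).exp := by
    have := EReal.exp_monotone hgreen
    rwa [ENNReal.exp_log] at this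
  rw [ENNReal.le_div_iff_mul_le (by simp [hl0]) (by simp)]
  refine le_trans ?_ hexp
  rw [← ENNReal.ofReal_coe_nnreal, ← ofReal_norm, ← ENNReal.ofReal_mul b.coe_nonneg]
  refine ENNReal.ofReal_le_ofReal (Real.le_sqrt_of_sq_le ?_)
  rw [mul_pow]; exact hl

end SibonyLeAzukawa

/-! ### Upper bounds for the Azukawa metric from linear discs -/

section AzukawaUpperBound

open Metric Set InnerProductSpace

variable {E : Type*} [NormedAddCommGroup E] [NormedSpace ℂ E]

/-- A Schwarz lemma: on an annulus, `u` is compared with `(1 - η) log (‖l‖ / ρ)`, which beats the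
logarithmic pole of `u` on a small inner circle; then `η → 0`. -/
theorem IsGreenCompetitor.le_log {D : Set E} {q Y : E} {u : E → EReal}
    (hu : IsGreenCompetitor D q u) {ρ : ℝ} (hY : Y ≠ 0)
    (hdisc : ∀ l : ℂ, ‖l‖ ≤ ρ → q + l • Y ∈ D) {l : ℂ} (hl0 : l ≠ 0) (hl : ‖l‖ ≤ ρ) :
    u (q + l • Y) ≤ ((Real.log ‖l‖ - Real.log ρ : ℝ) : EReal) := by
  obtain ⟨C, hC⟩ := hu.pole
  have hYn : 0 < ‖Y‖ := norm_pos_iff.2 hY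
  have hpole : ∀ x : ℂ, x ≠ 0 → ‖x‖ ≤ ρ →
      u (q + x • Y) ≤ ((Real.log ‖x‖ + (Real.log ‖Y‖ + C) : ℝ) : EReal) := by
    intro x hx0 hx
    have h := (hC _ (hdisc x hx) (by simp [hx0, hY])).le
    rwa [add_sub_cancel_left, norm_smul, Real.log_mul (norm_ne_zero_iff.2 hx0) hYn.ne',
      add_assoc] at h
  have hline := hu.psh.comp_line q Y
  have key : ∀ η ∈ Ioo (0 : ℝ) 1,
      u (q + l • Y) ≤ (((1 - η) * (Real.log ‖l‖ - Real.log ρ) : ℝ) : EReal) := by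
    intro η hη
    -- The first entry keeps `l` in the annulus; the second is the radius below which the pole bound
    -- lies under the comparison function.
    set ρ₁ := min ‖l‖ (Real.exp ((-(Real.log ‖Y‖ + C) - (1 - η) * Real.log ρ) / η)) with hρ₁
    have hl' : 0 < ‖l‖ := norm_pos_iff.2 hl0
    have hρ₁0 : 0 < ρ₁ := lt_min hl' (Real.exp_pos _)
    have hlog : η * Real.log ρ₁ ≤ -(Real.log ‖Y‖ + C) - (1 - η) * Real.log ρ := by
      have := (Real.log_le_iff_le_exp hρ₁0).2 (min_le_right ‖l‖ _)
      rwa [le_div_iff₀ hη.1, mul_comm] at this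
    have hKsub : closedBall (0 : ℂ) ρ \ ball 0 ρ₁ ⊆ {l | q + l • Y ∈ D} := fun x hx =>
      hdisc x (by simpa using hx.1)
    have hKne : ∀ x ∈ closedBall (0 : ℂ) ρ \ ball 0 ρ₁, x ≠ 0 := by
      rintro x hx rfl
      exact hx.2 (mem_ball_self hρ₁0)
    have hVK : ball (0 : ℂ) ρ \ closedBall 0 ρ₁ ⊆ closedBall (0 : ℂ) ρ \ ball 0 ρ₁ := fun x hx =>
      ⟨ball_subset_closedBall hx.1, fun h => hx.2 (ball_subset_closedBall h)⟩
    refine le_of_le_boundary (w := fun l : ℂ => u (q + l • Y))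
      (K := closedBall 0 ρ \ ball 0 ρ₁) (V := ball 0 ρ \ closedBall 0 ρ₁)
      (φ := fun x : ℂ => (1 - η) * (Real.log ‖x‖ - Real.log ρ))
      ((isCompact_closedBall 0 ρ).diff isOpen_ball) (isOpen_ball.sdiff isClosed_closedBall) hVK
      (hline.usc.mono hKsub) (fun x hx => hline.lt_top x (hKsub hx))
      (fun x hx => hline.submean x (hKsub (hVK hx)) 1) ?_ ?_ ?_ l
      ⟨by simpa using hl, by simp [hρ₁]⟩
    · refine ContinuousOn.mul continuousOn_const (ContinuousOn.sub ?_ continuousOn_const)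
      exact continuous_norm.continuousOn.log fun x hx => norm_ne_zero_iff.2 (hKne x hx)
    · intro p hp
      have hp0 : p + 0 ≠ 0 := by simpa using hKne p (hVK hp)
      have hev : ∀ᶠ l in 𝓝 (0 : ℂ), p + l ≠ 0 :=
        (show Continuous fun l : ℂ => p + l by fun_prop).continuousAt.eventually_ne hp0
      filter_upwards [hev] with x hx
      have h1 : AnalyticAt ℂ (fun l : ℂ => p + l) x := by fun_prop
      exact ((h1.harmonicAt_log_norm hx).sub (harmonicAt_const (Real.log ρ))).const_smul
        (c := 1 - η)
    · rintro x ⟨hx, hxV⟩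
      have hx0 := hKne x hx
      have hxρ : ‖x‖ ≤ ρ := by simpa using hx.1
      rcases hxρ.lt_or_eq with h | h
      · have hxe : ‖x‖ = ρ₁ := by
          have h1 : ρ₁ ≤ ‖x‖ := by simpa using hx.2
          refine le_antisymm ?_ h1
          by_contra! h2
          exact hxV ⟨by simpa using h, by simpa using h2⟩
        refine (hpole x hx0 hxρ).trans (EReal.coe_le_coe_iff.2 ?_)
        rw [hxe]
        linarith
      · rw [h, sub_self, mul_zero]
        exact (hu.neg _ (hdisc x hxρ)).le
  have hlim : Tendsto (fun η : ℝ => (((1 - η) * (Real.log ‖l‖ - Real.log ρ) : ℝ) : EReal))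
      (𝓝[>] 0) (𝓝 ((Real.log ‖l‖ - Real.log ρ : ℝ) : EReal)) := by
    refine EReal.tendsto_coe.2 (Tendsto.mono_left ?_ nhdsWithin_le_nhds)
    have : Continuous fun η : ℝ => (1 - η) * (Real.log ‖l‖ - Real.log ρ) := by fun_prop
    simpa using this.tendsto 0
  exact ge_of_tendsto hlim (by filter_upwards [Ioo_mem_nhdsGT one_pos] with η hη using key η hη)

/-- If all the linear discs of radius `s` through `q` in the directions `X + ζ • e`, `‖ζ‖ = R`,
lie in `D`, then `1 / s` bounds the Azukawa metric in the direction `X`. -/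
theorem azukawaMetric_le_of_discs {D : Set E} (hD : IsOpen D) {q X e : E} (hq : q ∈ D) {R s : ℝ}
    (hR : 0 < R) (hs : 0 < s) (hne : ∀ ζ : ℂ, ‖ζ‖ = R → X + ζ • e ≠ 0)
    (hdisc : ∀ ζ : ℂ, ‖ζ‖ = R → ∀ l : ℂ, ‖l‖ ≤ s → q + l • (X + ζ • e) ∈ D) :
    azukawaMetric D q X ≤ ENNReal.ofReal s⁻¹ := by
  obtain ⟨ρ, hρ, hball⟩ := Metric.nhds_basis_ball.mem_iff.1 (hD.mem_nhds hq)
  have hsmall : ∀ᶠ l : ℂ in 𝓝[≠] 0, l ≠ 0 ∧ ‖l‖ < s ∧ ‖l‖ * (‖X‖ + R * ‖e‖) < ρ := by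
    have h1 : ∀ᶠ l : ℂ in 𝓝 0, ‖l‖ < s :=
      continuous_norm.continuousAt.eventually_lt continuousAt_const (by simpa using hs)
    have h2 : ∀ᶠ l : ℂ in 𝓝 0, ‖l‖ * (‖X‖ + R * ‖e‖) < ρ :=
      ContinuousAt.eventually_lt (by fun_prop) continuousAt_const (by simpa using hρ)
    filter_upwards [self_mem_nhdsWithin, nhdsWithin_le_nhds h1, nhdsWithin_le_nhds h2]
      with l h h' h'' using ⟨h, h', h''⟩
  refine limsup_le_of_le (by isBoundedDefault) (hsmall.mono fun l ⟨hl0, hls, hlρ⟩ => ?_)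
  have hl0' : 0 < ‖l‖ := norm_pos_iff.2 hl0
  have hgreen : greenFunction D q (q + l • X) ≤
      ((Real.log ‖l‖ - Real.log s : ℝ) : EReal) := by
    refine iSup₂_le fun u hu => ?_
    have hline := hu.psh.comp_line (q + l • X) (l • e)
    have hmem : ∀ ζ ∈ closedBall (0 : ℂ) R, q + l • X + ζ • l • e ∈ D := by
      intro ζ hζ
      have hζ' : ‖ζ‖ ≤ R := by simpa using hζ
      apply hball
      rw [mem_ball, dist_eq_norm, add_assoc, add_sub_cancel_left]
      refine lt_of_le_of_lt (norm_add_le _ _) (lt_of_le_of_lt ?_ hlρ)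
      rw [norm_smul, norm_smul, norm_smul, mul_add]
      have : ‖ζ‖ * (‖l‖ * ‖e‖) ≤ R * (‖l‖ * ‖e‖) := by gcongr
      linarith
    -- With `l` fixed and small, the whole disc `‖ζ‖ ≤ R` maps into a ball about `q` inside `D`; the
    -- Schwarz bound is needed only on its boundary circle, and `ζ = 0` is the direction `X`.
    have := le_of_le_boundary (w := fun ζ : ℂ => u (q + l • X + ζ • l • e))
      (K := closedBall 0 R) (V := ball 0 R) (φ := fun _ => Real.log ‖l‖ - Real.log s)
      (isCompact_closedBall 0 R) isOpen_ball ball_subset_closedBall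
      (hline.usc.mono hmem) (fun x hx => hline.lt_top x (hmem x hx))
      (fun x hx => hline.submean x (hmem x (ball_subset_closedBall hx)) 1) continuousOn_const
      (fun p _ => Eventually.of_forall fun _ => harmonicAt_const _) ?_ 0 (by simpa using hR.le)
    · simpa using this
    · rintro ζ ⟨h1, h2⟩
      have hζ : ‖ζ‖ = R := le_antisymm (by simpa using h1) (by simpa using h2)
      have h3 := hu.le_log (hne ζ hζ) (hdisc ζ hζ) hl0 hls.le
      rwa [smul_add, smul_comm l ζ e, ← add_assoc] at h3
  rw [ENNReal.div_le_iff_le_mul (by simp [hl0]) (by simp), ← ofReal_norm,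
    ← ENNReal.ofReal_mul (by positivity)]
  refine (EReal.exp_monotone hgreen).trans ?_
  rw [EReal.exp_coe, ← Real.log_div hl0'.ne' hs.ne', Real.exp_log (by positivity)]
  exact ENNReal.ofReal_le_ofReal (by rw [div_eq_inv_mul])

end AzukawaUpperBound

/-! ### Splitting off the first coordinate; linear discs in the model domain -/

section Coordinates

variable {m : ℕ}

theorem norm_sq_eq_head_add_tail (z : EuclideanSpace ℂ (Fin (m + 1))) :
    ‖z‖ ^ 2 = ‖z 0‖ ^ 2 + ‖tail z‖ ^ 2 := by
  rw [EuclideanSpace.norm_sq_eq, EuclideanSpace.norm_sq_eq, Fin.sum_univ_succ]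
  rfl

theorem norm_tail_le (z : EuclideanSpace ℂ (Fin (m + 1))) : ‖tail z‖ ≤ ‖z‖ := by
  refine (sq_le_sq₀ (norm_nonneg _) (norm_nonneg _)).1 ?_
  rw [norm_sq_eq_head_add_tail z]
  nlinarith [sq_nonneg ‖z 0‖]

theorem norm_le_head_add_tail (z : EuclideanSpace ℂ (Fin (m + 1))) :
    ‖z‖ ≤ ‖z 0‖ + ‖tail z‖ := by
  refine (sq_le_sq₀ (norm_nonneg _) (by positivity)).1 ?_
  rw [norm_sq_eq_head_add_tail z]
  nlinarith [mul_nonneg (norm_nonneg (z 0)) (norm_nonneg (tail z))]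

theorem tail_add (z w : EuclideanSpace ℂ (Fin (m + 1))) : tail (z + w) = tail z + tail w := rfl

theorem tail_smul (a : ℂ) (z : EuclideanSpace ℂ (Fin (m + 1))) :
    tail (a • z) = a • tail z := rfl

/-- The projection `tail` as a continuous linear map. -/
noncomputable def tailL (m : ℕ) : EuclideanSpace ℂ (Fin (m + 1)) →L[ℂ] EuclideanSpace ℂ (Fin m) :=
  LinearMap.toContinuousLinearMap
    { toFun := tail
      map_add' := tail_add
      map_smul' := tail_smul }

@[simp]
theorem basePoint_zero (δ : ℝ) : basePoint m δ 0 = -(δ : ℂ) := by simp [basePoint]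

@[simp]
theorem tail_basePoint (δ : ℝ) : tail (basePoint m δ) = 0 := by
  ext i
  simp [basePoint, tail]

theorem norm_basePoint {δ : ℝ} (hδ : 0 ≤ δ) : ‖basePoint m δ‖ = δ := by
  simp [basePoint, abs_of_nonneg hδ]

/-- Bound of the Azukawa metric at `basePoint m δ` by linear discs, for a domain which near the
origin contains `Re (z 0) + C |Im (z 0)| < f ‖tail z‖`, when `f` grows at least linearly from `t` on. -/
theorem azukawaMetric_le_of_profile (hm : 1 ≤ m) {f : ℝ≥0 → ℝ≥0}
    {D : Set (EuclideanSpace ℂ (Fin (m + 1)))} (hD : IsOpen D) {C r₀ : ℝ} (hC : 0 ≤ C)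
    (hin : ∀ z : EuclideanSpace ℂ (Fin (m + 1)), ‖z‖ < r₀ →
      (z 0).re + C * |(z 0).im| < f ‖tail z‖₊ → z ∈ D)
    {δ t s : ℝ} (hδ : 0 < δ) (ht : 0 < t) (hs : 0 < s) (hr₀ : δ + s * (δ / t + 1) < r₀)
    (hlin : ∀ x : ℝ≥0, t ≤ x → δ * x ≤ f x * t) (X : EuclideanSpace ℂ (Fin (m + 1))) :
    azukawaMetric D (basePoint m δ) X ≤
      ENNReal.ofReal (2 * (1 + C) / s * (t / δ * ‖X 0‖ + ‖X‖)) := by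
  -- For `‖ζ‖ = R > N` the tail of `X + ζ • e` has norm at least `R - ‖tail X‖`, which makes the
  -- direction admissible in `hdisc`.
  set N := ‖tail X‖ + (1 + C) * (t / δ) * ‖X 0‖ with hN
  have hN0 : 0 ≤ N := by positivity
  have hNle : N ≤ (1 + C) * (t / δ * ‖X 0‖ + ‖X‖) := by
    have := norm_tail_le X
    nlinarith [mul_nonneg hC (norm_nonneg X)]
  have hdisc : ∀ Y : EuclideanSpace ℂ (Fin (m + 1)), (1 + C) * (t / δ) * ‖Y 0‖ ≤ ‖tail Y‖ →
      ‖tail Y‖ ≤ s → basePoint m δ + Y ∈ D := by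
    intro Y hY hYs
    have hY0 : (1 + C) * ‖Y 0‖ ≤ δ / t * ‖tail Y‖ := by
      rw [div_mul_eq_mul_div, le_div_iff₀ ht]
      calc (1 + C) * ‖Y 0‖ * t = δ * ((1 + C) * (t / δ) * ‖Y 0‖) := by field_simp
        _ ≤ δ * ‖tail Y‖ := by gcongr
    have hdt : 0 < δ / t := by positivity
    apply hin
    · refine lt_of_le_of_lt ?_ hr₀
      refine (norm_add_le _ _).trans ?_
      rw [norm_basePoint hδ.le]
      have h1 := norm_le_head_add_tail Y
      have h2 : ‖Y 0‖ ≤ δ / t * s := by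
        have : δ / t * ‖tail Y‖ ≤ δ / t * s := by gcongr
        nlinarith [mul_nonneg hC (norm_nonneg (Y 0))]
      nlinarith
    · have h1 : ((basePoint m δ + Y) 0).re = -δ + (Y 0).re := by simp
      have h2 : ((basePoint m δ + Y) 0).im = (Y 0).im := by simp
      have h3 : tail (basePoint m δ + Y) = tail Y := by rw [tail_add, tail_basePoint, zero_add]
      rw [h1, h2, h3]
      have h4 : (Y 0).re + C * |(Y 0).im| ≤ (1 + C) * ‖Y 0‖ := by
        have := (Y 0).re_le_norm
        have := mul_le_mul_of_nonneg_left (Y 0).abs_im_le_norm hC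
        linarith
      rcases lt_or_ge ‖tail Y‖ t with h5 | h5
      · have h6 : δ / t * ‖tail Y‖ < δ := by
          calc δ / t * ‖tail Y‖ < δ / t * t := by gcongr
            _ = δ := by field_simp
        have : (0 : ℝ) ≤ f ‖tail Y‖₊ := NNReal.coe_nonneg _
        linarith
      · have h6 := hlin ‖tail Y‖₊ (by simpa using h5)
        have h7 : δ / t * ‖tail Y‖ ≤ f ‖tail Y‖₊ := by
          rw [div_mul_eq_mul_div, div_le_iff₀ ht]
          simpa using h6
        linarith
  have hq : basePoint m δ ∈ D := by
    simpa using hdisc 0 (by simp) (by simpa [show tail (0 : EuclideanSpace ℂ (Fin (m + 1))) = 0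
      from rfl] using hs.le)
  let e : EuclideanSpace ℂ (Fin (m + 1)) := EuclideanSpace.single (Fin.succ ⟨0, hm⟩) 1
  have he0 : e 0 = 0 := by simp [e]
  have het : ‖tail e‖ = 1 := by
    have h1 := norm_sq_eq_head_add_tail e
    have h2 : ‖e‖ = 1 := by simp [e]
    rw [he0, h2] at h1
    have h3 : ‖tail e‖ ^ 2 = 1 := by simpa using h1.symm
    nlinarith [norm_nonneg (tail e)]
  have hbound : ∀ R : ℝ, N < R → azukawaMetric D (basePoint m δ) X ≤
      ENNReal.ofReal (2 * R / s) := by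
    intro R hR
    have hR0 : 0 < R := hN0.trans_lt hR
    have htail : ∀ ζ : ℂ, ‖ζ‖ = R → R - ‖tail X‖ ≤ ‖tail (X + ζ • e)‖ ∧
        ‖tail (X + ζ • e)‖ ≤ 2 * R := by
      intro ζ hζ
      have h1 : ‖ζ • tail e‖ = R := by rw [norm_smul, het, hζ, mul_one]
      rw [tail_add, tail_smul]
      have h2 := norm_sub_norm_le (ζ • tail e) (-tail X)
      have h3 := norm_add_le (tail X) (ζ • tail e)
      rw [sub_neg_eq_add, norm_neg, add_comm (ζ • tail e)] at h2
      have h4 : 0 ≤ (1 + C) * (t / δ) * ‖X 0‖ := by positivity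
      constructor <;> linarith
    have h := azukawaMetric_le_of_discs hD (X := X) (e := e) hq hR0
      (s := s / (2 * R)) (by positivity) ?_ ?_
    · rwa [inv_div] at h
    · intro ζ hζ h0
      have h1 := (htail ζ hζ).1
      rw [h0] at h1
      have h2 : ‖tail (0 : EuclideanSpace ℂ (Fin (m + 1)))‖ = 0 := norm_zero
      have h4 : 0 ≤ (1 + C) * (t / δ) * ‖X 0‖ := by positivity
      linarith
    · intro ζ hζ l hl
      obtain ⟨h1, h2⟩ := htail ζ hζ
      apply hdisc
      · have h3 : (l • (X + ζ • e)) 0 = l * X 0 := by simp [he0]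
        rw [h3, tail_smul, norm_mul, norm_smul, mul_left_comm]
        refine mul_le_mul_of_nonneg_left ?_ (norm_nonneg l)
        linarith
      · rw [tail_smul, norm_smul]
        calc ‖l‖ * ‖tail (X + ζ • e)‖ ≤ s / (2 * R) * (2 * R) := by gcongr
          _ = s := by field_simp
  -- Each disc bound needs `R > N` strictly (`N` is `0` when `X = 0`), so the bound at `N` is
  -- reached as a limit.
  have hlim : Tendsto (fun R : ℝ => ENNReal.ofReal (2 * R / s)) (𝓝[>] N)
      (𝓝 (ENNReal.ofReal (2 * N / s))) := by
    refine Tendsto.mono_left ?_ nhdsWithin_le_nhds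
    exact (ENNReal.continuous_ofReal.comp (by fun_prop)).tendsto N
  refine (ge_of_tendsto hlim (eventually_mem_nhdsWithin.mono hbound)).trans
    (ENNReal.ofReal_le_ofReal ?_)
  calc 2 * N / s ≤ 2 * ((1 + C) * (t / δ * ‖X 0‖ + ‖X‖)) / s := by gcongr
    _ = _ := by ring

end Coordinates

/-! ### Lower bounds for the Sibony metric from explicit competitors -/

section SibonyLowerBound

open Metric Set

theorem IsSibonyCompetitor.le_sibonyMetric {E : Type*} [NormedAddCommGroup E] [NormedSpace ℂ E]
    {D : Set E} {z : E} {v : E → ℝ} (hD : IsOpen D) (hz : z ∈ D) (hv : IsSibonyCompetitor D z v)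
    {X : E} {k : ℝ} (hk : ∀ᶠ l : ℂ in 𝓝 0, (k * ‖l‖) ^ 2 ≤ v (z + l • X)) :
    ENNReal.ofReal k ≤ sibonyMetric D z X := by
  have hnn : ∀ᶠ w in 𝓝 z, 0 ≤ v w :=
    (hD.eventually_mem hz).mono fun w hw => hv.nonneg w hw
  have hlevi : k ^ 2 ≤ leviForm v z X := by
    refine ge_of_tendsto (tendsto_leviForm hv.smooth hv.map_base hnn X) ?_
    have ht1 : Tendsto (fun r : ℝ => (r : ℂ)) (𝓝[>] 0) (𝓝 0) :=
      (by simpa using Complex.continuous_ofReal.tendsto (0 : ℝ) :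
        Tendsto (fun r : ℝ => (r : ℂ)) (𝓝 0) (𝓝 0)).mono_left nhdsWithin_le_nhds
    have ht2 : Tendsto (fun r : ℝ => (r * Complex.I : ℂ)) (𝓝[>] 0) (𝓝 0) := by
      simpa using ht1.mul_const Complex.I
    filter_upwards [ht1.eventually hk, ht2.eventually hk, self_mem_nhdsWithin] with r h1 h2 h3
    have hr : (0 : ℝ) < r := h3
    rw [le_div_iff₀ (by positivity)]
    simp only [norm_mul, Complex.norm_real, Complex.norm_I, mul_one, Real.norm_eq_abs,
      mul_pow, sq_abs] at h1 h2
    linarith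
  exact le_iSup₂_of_le v hv (ENNReal.ofReal_le_ofReal (Real.le_sqrt_of_sq_le hlevi))

variable {m : ℕ}

theorem ofReal_norm_div_le_sibonyMetric {E : Type*} [NormedAddCommGroup E]
    [InnerProductSpace ℂ E] {D : Set E} {z : E} (hD : IsOpen D) (hz : z ∈ D) {R : ℝ} (hR : 0 < R)
    (hDR : ∀ w ∈ D, ‖w - z‖ < R) (X : E) :
    ENNReal.ofReal (‖X‖ / R) ≤ sibonyMetric D z X := by
  have hv : IsSibonyCompetitor D z fun w => (R ^ 2)⁻¹ * ‖w - z‖ ^ 2 := by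
    refine ⟨fun w _ => by positivity, fun w hw => ?_, by simp, ?_, ?_⟩
    · rw [inv_mul_lt_iff₀ (by positivity), mul_one]
      exact pow_lt_pow_left₀ (hDR w hw) (norm_nonneg _) two_ne_zero
    · refine isPSHOn_log_of_hasHolomorphicSupport (by fun_prop) fun w hw hpos => ?_
      refine (hasHolomorphicSupport_norm_sq (G := fun w => w - z)
        (Eventually.of_forall fun w => by fun_prop) ?_).const_mul (by positivity)
      intro h
      simp [h] at hpos
    · exact contDiffAt_const.mul ((contDiffAt_id.sub contDiffAt_const).norm_sq ℂ)
  refine hv.le_sibonyMetric hD hz (Eventually.of_forall fun l => le_of_eq ?_)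
  rw [add_sub_cancel_left, norm_smul]
  field_simp

/-- If on the bounded set `D` the inequality `‖z 0 - 2 δ‖ < κ δ` forces `‖tail z‖ ≥ τ`, then the
Sibony metric at `basePoint m δ` is at least a multiple of `τ / δ * ‖X 0‖`. The competitor is glued
from `‖(A τ (z 0 + δ) / (z 0 - 2 δ), tail z / 2)‖ ^ 2`, which is used near the base point, and
`‖tail z‖ ^ 2 * (‖tail z‖ / τ) ^ (2 / log (1 / τ))`, which is used near `z 0 = 2 δ`. -/
theorem ofReal_le_sibonyMetric_basePoint {D : Set (EuclideanSpace ℂ (Fin (m + 1)))}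
    (hD : IsOpen D) {δ τ κ R : ℝ} (hδ : 0 < δ) (hq : basePoint m δ ∈ D) (hτ : 0 < τ)
    (hτ1 : τ ≤ Real.exp (-1)) (hκ : 0 < κ) (hκ1 : κ ≤ 1) (hR : 1 ≤ R) (hDR : ∀ z ∈ D, ‖z‖ ≤ R)
    (hgap : ∀ z ∈ D, ‖z 0 - 2 * (δ : ℂ)‖ < κ * δ → τ ≤ ‖tail z‖)
    (X : EuclideanSpace ℂ (Fin (m + 1))) :
    ENNReal.ofReal (κ / (56 * Real.sqrt (Real.exp 2 * R ^ 4 + 1)) * (τ / δ * ‖X 0‖)) ≤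
      sibonyMetric D (basePoint m δ) X := by
  set M := Real.exp 2 * R ^ 4 + 1 with hM
  have hM0 : 0 < M := by positivity
  have hlogτ : Real.log τ ≤ -1 := (Real.log_le_iff_le_exp hτ).2 hτ1
  -- Chosen so that `τ ^ (2 * e) = exp (-2)`: the factor `exp 2` normalizes `v₂` at `‖tail z‖ = τ`,
  -- and `e ≤ 1` bounds `v₂` on `D` independently of `τ`.
  set e := -(Real.log τ)⁻¹ with he
  have he0 : 0 < e := by
    rw [he, ← inv_neg]
    exact inv_pos.2 (by linarith)
  have he1 : e ≤ 1 := by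
    rw [he, ← inv_neg]
    exact inv_le_one_of_one_le₀ (by linarith)
  have hτe : Real.exp 2 * (τ ^ 2) ^ e = 1 := by
    rw [Real.rpow_def_of_pos (by positivity), ← Real.exp_add, Real.log_pow, he]
    have : Real.log τ ≠ 0 := by linarith
    rw [show (2 : ℝ) + ((2 : ℕ) : ℝ) * Real.log τ * -(Real.log τ)⁻¹ = 0 by
      push_cast; field_simp; ring, Real.exp_zero]
  have hτ1' : τ ≤ 1 := hτ1.trans (Real.exp_le_one_iff.2 (by norm_num))
  -- Where `‖x - 2δ‖ ≥ κδ/2`, `‖F x‖ ≤ 1 + 6/κ ≤ 7/κ`, so `A ‖F x‖ ≤ 1/2`.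
  set A := κ / 14 with hA
  have hA0 : 0 < A := by positivity
  let F : ℂ → ℂ := fun x => (x + δ) / (x - 2 * δ)
  have hF : ∀ x : ℂ, κ * δ / 2 ≤ ‖x - 2 * (δ : ℂ)‖ → A * τ * ‖F x‖ ≤ τ / 2 := by
    intro x hx
    have hx0 : 0 < ‖x - 2 * (δ : ℂ)‖ := lt_of_lt_of_le (by positivity) hx
    have h1 : ‖x + δ‖ ≤ ‖x - 2 * (δ : ℂ)‖ + 3 * δ := by
      calc ‖x + δ‖ = ‖(x - 2 * δ) + ((3 * δ : ℝ) : ℂ)‖ := by push_cast; ring_nf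
        _ ≤ _ := (norm_add_le _ _).trans (by
          rw [Complex.norm_real, Real.norm_of_nonneg (by positivity)])
    have h2 : A * ‖F x‖ ≤ 1 / 2 := by
      rw [norm_div, mul_div_assoc', div_le_iff₀ hx0, hA]
      nlinarith [norm_nonneg (x + δ)]
    nlinarith
  let e₀ : EuclideanSpace ℂ (Fin (m + 1)) := EuclideanSpace.single 0 1
  let G : EuclideanSpace ℂ (Fin (m + 1)) → EuclideanSpace ℂ (Fin (m + 1)) := fun z =>
    (1 / 2 : ℂ) • z + ((A * τ : ℝ) * F (z 0) - (1 / 2 : ℂ) * z 0) • e₀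
  have hG0 : ∀ z, G z 0 = (A * τ : ℝ) * F (z 0) := fun z => by simp [G, e₀]
  have hGt : ∀ z, tail (G z) = (1 / 2 : ℂ) • tail z := fun z => by
    ext i
    simp [G, e₀, tail]
  have hGn : ∀ z, ‖G z‖ ^ 2 = (A * τ * ‖F (z 0)‖) ^ 2 + ‖tail z‖ ^ 2 / 4 := fun z => by
    rw [norm_sq_eq_head_add_tail, hG0, hGt, norm_mul, norm_smul, Complex.norm_real,
      Real.norm_of_nonneg (by positivity)]
    norm_num
    ring
  let v₂ : EuclideanSpace ℂ (Fin (m + 1)) → ℝ := fun z => Real.exp 2 * (‖tail z‖ ^ 2) ^ (1 + e)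
  have hv₂eq : ∀ z, v₂ z = ‖tail z‖ ^ 2 * (Real.exp 2 * (‖tail z‖ ^ 2) ^ e) := fun z => by
    simp only [v₂]
    rw [Real.rpow_add' (by positivity) (by positivity), Real.rpow_one]
    ring
  have hv₂nn : ∀ z, 0 ≤ v₂ z := fun z => by positivity
  have hv₂ge : ∀ z, τ ≤ ‖tail z‖ → ‖tail z‖ ^ 2 ≤ v₂ z := fun z hz => by
    rw [hv₂eq]
    refine le_mul_of_one_le_right (by positivity) ?_
    rw [← hτe]
    gcongr
  have htailc : Continuous (tail : EuclideanSpace ℂ (Fin (m + 1)) → _) := (tailL m).continuous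
  have hv₂c : Continuous v₂ :=
    continuous_const.mul ((htailc.norm.pow 2).rpow_const fun z => Or.inr (by positivity))
  have hGc : ∀ z, z 0 - 2 * (δ : ℂ) ≠ 0 → ContDiffAt ℂ 2 G z := fun z hz => by
    have h0 : ContDiff ℂ 2 fun z : EuclideanSpace ℂ (Fin (m + 1)) => z 0 :=
      (EuclideanSpace.proj (0 : Fin (m + 1)) : EuclideanSpace ℂ (Fin (m + 1)) →L[ℂ] ℂ).contDiff
    have h1 : ContDiffAt ℂ 2 (fun z : EuclideanSpace ℂ (Fin (m + 1)) => F (z 0)) z :=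
      (h0.contDiffAt.add contDiffAt_const).div (h0.contDiffAt.sub contDiffAt_const) hz
    exact (contDiffAt_id.const_smul _).add
      (((contDiffAt_const.mul h1).sub (contDiffAt_const.mul h0.contDiffAt)).smul contDiffAt_const)
  -- The pieces match on the collar `κδ/2 < ‖z 0 - 2δ‖ < κδ`: in `D` one has `‖tail z‖ ≥ τ` there,
  -- so `‖G z‖² ≤ τ²/4 + ‖tail z‖²/4 ≤ v₂ z` and the maximum is already `v₂`.
  let v : EuclideanSpace ℂ (Fin (m + 1)) → ℝ := fun z =>
    if ‖z 0 - 2 * (δ : ℂ)‖ ≤ κ * δ / 2 then v₂ z else max (‖G z‖ ^ 2) (v₂ z)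
  have hfar : ∀ z, κ * δ / 2 < ‖z 0 - 2 * (δ : ℂ)‖ → v z = max (‖G z‖ ^ 2) (v₂ z) := fun z hz =>
    if_neg (not_le.2 hz)
  have hnear : ∀ z ∈ D, ‖z 0 - 2 * (δ : ℂ)‖ < κ * δ → v z = v₂ z := fun z hz hzn => by
    rcases le_or_gt ‖z 0 - 2 * (δ : ℂ)‖ (κ * δ / 2) with h | h
    · exact if_pos h
    · rw [hfar z h, max_eq_right]
      have hτz := hgap z hz hzn
      refine le_trans ?_ (hv₂ge z hτz)
      rw [hGn]
      have h1 : (A * τ * ‖F (z 0)‖) ^ 2 ≤ (τ / 2) ^ 2 :=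
        pow_le_pow_left₀ (by positivity) (hF _ h.le) 2
      have h2 : τ ^ 2 ≤ ‖tail z‖ ^ 2 := pow_le_pow_left₀ hτ.le hτz 2
      nlinarith
  have hdist : Continuous fun z : EuclideanSpace ℂ (Fin (m + 1)) => ‖z 0 - 2 * (δ : ℂ)‖ := by fun_prop
  have hfar' : ∀ z, κ * δ / 2 < ‖z 0 - 2 * (δ : ℂ)‖ → v =ᶠ[𝓝 z] fun z => max (‖G z‖ ^ 2) (v₂ z) :=
    fun z hz => (hdist.continuousAt.eventually_const_lt hz).mono hfar
  have hnear' : ∀ z ∈ D, ‖z 0 - 2 * (δ : ℂ)‖ < κ * δ → v =ᶠ[𝓝 z] v₂ := fun z hz hzn => by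
    filter_upwards [hD.mem_nhds hz, hdist.continuousAt.eventually_lt_const hzn] with w hw hwn
      using hnear w hw hwn
  have hcases : ∀ z : EuclideanSpace ℂ (Fin (m + 1)),
      κ * δ / 2 < ‖z 0 - 2 * (δ : ℂ)‖ ∨ ‖z 0 - 2 * (δ : ℂ)‖ < κ * δ := fun z => by
    rcases le_or_gt (κ * δ) ‖z 0 - 2 * (δ : ℂ)‖ with h | h
    · exact Or.inl (by nlinarith [mul_pos hκ hδ])
    · exact Or.inr h
  have hne : ∀ z : EuclideanSpace ℂ (Fin (m + 1)), κ * δ / 2 < ‖z 0 - 2 * (δ : ℂ)‖ →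
      z 0 - 2 * (δ : ℂ) ≠ 0 := fun z hz h => by
    rw [h, norm_zero] at hz
    nlinarith [mul_pos hκ hδ]
  have hbound : ∀ z ∈ D, v z < M := fun z hz => by
    have htz : ‖tail z‖ ^ 2 ≤ R ^ 2 :=
      pow_le_pow_left₀ (norm_nonneg _) ((norm_tail_le z).trans (hDR z hz)) 2
    have hR2 : 1 ≤ R ^ 2 := one_le_pow₀ hR
    have h2 : v₂ z < M := by
      have : (‖tail z‖ ^ 2) ^ (1 + e) ≤ R ^ 4 := by
        calc (‖tail z‖ ^ 2) ^ (1 + e) ≤ (R ^ 2) ^ (1 + e) := by gcongr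
          _ ≤ (R ^ 2) ^ (2 : ℝ) := Real.rpow_le_rpow_of_exponent_le hR2 (by linarith)
          _ = R ^ 4 := by rw [Real.rpow_two]; ring
      have := mul_le_mul_of_nonneg_left this (Real.exp_pos 2).le
      simp only [v₂, hM]
      linarith
    rcases le_or_gt ‖z 0 - 2 * (δ : ℂ)‖ (κ * δ / 2) with h | h
    · simpa only [v, if_pos h] using h2
    · rw [hfar z h]
      refine max_lt ?_ h2
      have h1 : (A * τ * ‖F (z 0)‖) ^ 2 ≤ (τ / 2) ^ 2 :=
        pow_le_pow_left₀ (by positivity) (hF _ h.le) 2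
      have h3 : R ^ 2 ≤ R ^ 4 := pow_le_pow_right₀ hR (by norm_num)
      have h4 : 1 ≤ Real.exp 2 := Real.one_le_exp (by norm_num)
      have h5 : R ^ 4 ≤ Real.exp 2 * R ^ 4 := le_mul_of_one_le_left (by positivity) h4
      rw [hGn, hM]
      nlinarith
  have hq3 : ‖basePoint m δ 0 - 2 * (δ : ℂ)‖ = 3 * δ := by
    rw [basePoint_zero, show -(δ : ℂ) - 2 * δ = -((3 * δ : ℝ) : ℂ) by push_cast; ring, norm_neg,
      Complex.norm_real, Real.norm_of_nonneg (by positivity)]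
  have hqfar : κ * δ / 2 < ‖basePoint m δ 0 - 2 * (δ : ℂ)‖ := by
    rw [hq3]; nlinarith
  -- Near the base point `v₂` is `‖tail z‖²` times a factor tending to `0`, hence below the term
  -- `‖tail z‖²/4` of `‖G z‖²`. This gives the smoothness that a maximum would not.
  have hvq : v =ᶠ[𝓝 (basePoint m δ)] fun z => ‖G z‖ ^ 2 := by
    have h1 : Continuous fun z : EuclideanSpace ℂ (Fin (m + 1)) =>
        Real.exp 2 * (‖tail z‖ ^ 2) ^ e :=
      continuous_const.mul ((htailc.norm.pow 2).rpow_const fun z => Or.inr he0.le)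
    have h2 : ∀ᶠ z in 𝓝 (basePoint m δ), Real.exp 2 * (‖tail z‖ ^ 2) ^ e < 1 / 4 :=
      h1.continuousAt.eventually_lt_const (by simp [Real.zero_rpow he0.ne'])
    filter_upwards [hfar' _ hqfar, h2] with z hz hz2
    rw [hz]
    refine max_eq_left ?_
    rw [hv₂eq, hGn]
    nlinarith [sq_nonneg (A * τ * ‖F (z 0)‖), sq_nonneg ‖tail z‖]
  have hvnn : ∀ z, 0 ≤ v z := fun z => by
    simp only [v]
    split_ifs
    exacts [hv₂nn z, (hv₂nn z).trans (le_max_right _ _)]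
  have hsupp₂ : ∀ z, 0 < v₂ z → HasHolomorphicSupport v₂ z := fun z hz => by
    have ht0 : tail z ≠ 0 := by
      intro h
      have : v₂ z = 0 := by rw [hv₂eq, h]; simp
      exact hz.ne' this
    have h1 : HasHolomorphicSupport (fun z => ‖tail z‖ ^ 2) z :=
      hasHolomorphicSupport_norm_sq (G := tail)
        (Eventually.of_forall fun w => (tailL m).differentiableAt) ht0
    exact (h1.rpow (by have := norm_pos_iff.2 ht0; positivity)
      (by positivity : (0 : ℝ) ≤ 1 + e)).const_mul (Real.exp_pos 2).le
  have hcomp : IsSibonyCompetitor D (basePoint m δ) fun z => M⁻¹ * v z := by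
    refine ⟨fun z _ => mul_nonneg (inv_nonneg.2 hM0.le) (hvnn z), fun z hz => ?_, ?_, ?_, ?_⟩
    · rw [inv_mul_lt_iff₀ hM0, mul_one]
      exact hbound z hz
    · simp only [hvq.self_of_nhds, hGn]
      simp [F]
    · refine isPSHOn_log_of_hasHolomorphicSupport ?_ fun z hz hpos => ?_
      · refine continuousOn_const.mul fun z hz => ContinuousAt.continuousWithinAt ?_
        rcases hcases z with h | h
        · refine ContinuousAt.congr ?_ (hfar' z h).symm
          exact ((hGc z (hne z h)).continuousAt.norm.pow 2).max hv₂c.continuousAt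
        · exact hv₂c.continuousAt.congr (hnear' z hz h).symm
      · refine HasHolomorphicSupport.const_mul ?_ (inv_nonneg.2 hM0.le)
        have hvpos : 0 < v z := pos_of_mul_pos_right hpos (inv_nonneg.2 hM0.le)
        rcases hcases z with h | h
        · rw [hfar z h] at hvpos
          refine (HasHolomorphicSupport.max (fun h1 => ?_) (hsupp₂ z) hvpos).mono (hfar z h).symm
            ((hfar' z h).symm.le)
          refine hasHolomorphicSupport_norm_sq ?_ fun h0 => by simp [h0] at h1
          filter_upwards [hdist.continuousAt.eventually_const_lt h] with w hw
            using (hGc w (hne w hw)).differentiableAt two_ne_zero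
        · rw [hnear z hz h] at hvpos
          exact (hsupp₂ z hvpos).mono (hnear z hz h).symm ((hnear' z hz h).symm.le)
    · refine contDiffAt_const.mul (ContDiffAt.congr_of_eventuallyEq ?_ hvq)
      exact ((hGc _ (hne _ hqfar)).restrict_scalars ℝ).norm_sq ℂ
  refine hcomp.le_sibonyMetric hD hq ?_
  have hcont : Tendsto (fun l : ℂ => basePoint m δ + l • X) (𝓝 0) (𝓝 (basePoint m δ)) := by
    have : Continuous fun l : ℂ => basePoint m δ + l • X := by fun_prop
    simpa using this.tendsto 0
  -- The distance is `3δ` at the base point; the bound `4δ` together with `A = κ/14` produces the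
  -- constant `56`.
  have h4δ : ∀ᶠ z in 𝓝 (basePoint m δ), ‖z 0 - 2 * (δ : ℂ)‖ < 4 * δ :=
    hdist.continuousAt.eventually_lt_const (hq3.trans_lt (by linarith))
  filter_upwards [hcont.eventually (hvq.and (h4δ.and (hdist.continuousAt.eventually_const_lt
    hqfar)))] with l ⟨hl1, hl2, hl3⟩
  set z := basePoint m δ + l • X with hz
  have hz0 : z 0 + δ = l * X 0 := by simp [hz]
  have hzpos : 0 < ‖z 0 - 2 * (δ : ℂ)‖ := norm_pos_iff.2 (hne z hl3)
  have hFz : ‖l‖ * ‖X 0‖ / (4 * δ) ≤ ‖F (z 0)‖ := by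
    rw [norm_div, hz0, norm_mul]
    exact div_le_div_of_nonneg_left (by positivity) hzpos hl2.le
  have hsq : Real.sqrt M ^ 2 = M := Real.sq_sqrt hM0.le
  have hsM : 0 < Real.sqrt M := Real.sqrt_pos.2 hM0
  rw [hl1, hGn, inv_mul_eq_div, le_div_iff₀ hM0]
  nth_rw 2 [← hsq]
  rw [← mul_pow]
  have h5 : κ / (56 * Real.sqrt M) * (τ / δ * ‖X 0‖) * ‖l‖ * Real.sqrt M =
      A * τ * (‖l‖ * ‖X 0‖ / (4 * δ)) := by
    rw [hA]; field_simp; ring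
  rw [h5]
  have h6 : (A * τ * (‖l‖ * ‖X 0‖ / (4 * δ))) ^ 2 ≤ (A * τ * ‖F (z 0)‖) ^ 2 := by gcongr
  nlinarith [sq_nonneg ‖tail z‖]

end SibonyLowerBound

/-! ### Consequences of the monotonicity of `f t / t` -/

section Profile

variable {f : ℝ≥0 → ℝ≥0}

theorem mul_le_mul_of_monotoneOn_div (hmono : MonotoneOn (fun t => f t / t) (Set.Ioi 0))
    {t x : ℝ≥0} (ht : 0 < t) (hx : t ≤ x) : f t * x ≤ f x * t := by
  have h := hmono ht (ht.trans_le hx) hx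
  rwa [div_le_div_iff₀ ht (ht.trans_le hx)] at h

theorem le_of_apply_lt_apply (hf0 : f 0 = 0)
    (hmono : MonotoneOn (fun t => f t / t) (Set.Ioi 0)) {t x : ℝ≥0} (h : f t < f x) : t ≤ x := by
  by_contra! hxt
  rcases eq_or_ne x 0 with rfl | hx
  · rw [hf0] at h
    exact not_lt_zero h
  · have hx0 : 0 < x := pos_iff_ne_zero.2 hx
    have h1 := mul_le_mul_of_monotoneOn_div hmono hx0 hxt.le
    have h2 : f t * x < f x * t := mul_lt_mul'' h hxt zero_le zero_le
    exact h2.not_ge h1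

end Profile

end InvariantMetrics

/-! ### The estimate: choice of constants and assembly -/

theorem proposition6 (m : ℕ) (hm : 1 ≤ m)
    (f : ℝ≥0 → ℝ≥0) (hf : Continuous f) (hf0 : f 0 = 0) (hfne : f ≠ 0)
    (hmono : MonotoneOn (fun t => f t / t) (Set.Ioi 0))
    (D : Set (EuclideanSpace ℂ (Fin (m + 1))))
    (hDopen : IsOpen D) (hDconn : IsConnected D) (hDbdd : Bornology.IsBounded D)
    (h0 : (0 : EuclideanSpace ℂ (Fin (m + 1))) ∈ frontier D)
    (h : EuclideanSpace ℂ (Fin (m + 1)) → ℝ)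
    (hO : h =O[𝓝 0] fun z => (z 0).im)
    (hD : ∀ᶠ z in 𝓝 (0 : EuclideanSpace ℂ (Fin (m + 1))),
      z ∈ D ↔ (z 0).re + h z < (f ‖InvariantMetrics.tail z‖₊ : ℝ)) :
    ∃ c : ℝ, 1 < c ∧ ∃ δ₀ : ℝ, 0 < δ₀ ∧ ∀ δ : ℝ, 0 < δ → δ < δ₀ →
      InvariantMetrics.basePoint m δ ∈ D ∧
      ∀ X : EuclideanSpace ℂ (Fin (m + 1)),
        ENNReal.ofReal (c⁻¹ * InvariantMetrics.modelB f δ X) ≤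
            InvariantMetrics.sibonyMetric D (InvariantMetrics.basePoint m δ) X ∧
        InvariantMetrics.sibonyMetric D (InvariantMetrics.basePoint m δ) X ≤
            InvariantMetrics.azukawaMetric D (InvariantMetrics.basePoint m δ) X ∧
        InvariantMetrics.azukawaMetric D (InvariantMetrics.basePoint m δ) X ≤
            ENNReal.ofReal (c * InvariantMetrics.modelB f δ X) := by
  obtain ⟨C, hC, hO⟩ := hO.exists_pos
  obtain ⟨r₀, hr₀, hball⟩ := Metric.nhds_basis_ball.eventually_iff.1 (hD.and hO.bound)
  have hloc : ∀ z : EuclideanSpace ℂ (Fin (m + 1)), ‖z‖ < r₀ →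
      (z ∈ D ↔ (z 0).re + h z < f ‖InvariantMetrics.tail z‖₊) ∧ |h z| ≤ C * |(z 0).im| :=
    fun z hz => by simpa using hball (x := z) (by simpa using hz)
  have hin : ∀ z : EuclideanSpace ℂ (Fin (m + 1)), ‖z‖ < r₀ →
      (z 0).re + C * |(z 0).im| < f ‖InvariantMetrics.tail z‖₊ → z ∈ D := fun z hz hlt => by
    obtain ⟨h1, h2⟩ := hloc z hz
    exact h1.2 (by linarith [le_abs_self (h z)])
  have hout : ∀ z ∈ D, ‖z‖ < r₀ →
      (z 0).re - C * |(z 0).im| < f ‖InvariantMetrics.tail z‖₊ := fun z hzD hz => by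
    obtain ⟨h1, h2⟩ := hloc z hz
    linarith [h1.1 hzD, neg_abs_le (h z)]
  obtain ⟨a, ha⟩ : ∃ a, f a ≠ 0 := by
    by_contra! hcon
    exact hfne (funext hcon)
  have hfa : 0 < f a := pos_iff_ne_zero.2 ha
  have ha0 : 0 < a := by
    rcases eq_or_ne a 0 with h | h
    · exact absurd (h ▸ hf0) ha
    · exact pos_iff_ne_zero.2 h
  obtain ⟨R', hR'⟩ := hDbdd.exists_norm_le
  set R := max R' 1 with hR
  have hR1 : 1 ≤ R := le_max_right _ _
  have hDR : ∀ z ∈ D, ‖z‖ ≤ R := fun z hz => (hR' z hz).trans (le_max_left _ _)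
  set K : ℝ := f a / a with hK
  have hK0 : 0 ≤ K := by positivity
  -- `K` bounds the slope `δ / T` because `T ≤ a`, so discs of tail radius `s` stay in the ball
  -- where `D` is described by `f`.
  set s := r₀ / (2 * (K + 1)) with hs
  have hs0 : 0 < s := by positivity
  set τ₀ := min (r₀ / 2) (Real.exp (-1)) with hτ₀
  have hτ₀0 : 0 < τ₀ := lt_min (by positivity) (Real.exp_pos _)
  set L := 1 + (a : ℝ) / τ₀ with hL
  have hL0 : 0 < L := by positivity
  -- Then `‖z 0 - 2δ‖ < κδ` forces `Re (z 0) - C |Im (z 0)| > δ`, hence `f ‖tail z‖ > δ` for points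
  -- of `D` near `0`.
  set κ := 1 / (1 + C) with hκ
  have hκ0 : 0 < κ := by positivity
  have hκ1 : κ ≤ 1 := by
    rw [hκ, div_le_one (by positivity)]
    linarith
  set k := κ / (56 * Real.sqrt (Real.exp 2 * R ^ 4 + 1)) with hk
  have hk0 : 0 < k := by positivity
  -- The halves pay for bounding a sum of two terms by their maximum.
  set b := min (k / (2 * L)) (1 / (2 * (2 * R + 1))) with hb
  have hb0 : 0 < b := lt_min (by positivity) (by positivity)
  set c := max 2 (max (2 * (1 + C) / s) b⁻¹) with hc
  have hc2 : 2 ≤ c := le_max_left _ _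
  have hcs : 2 * (1 + C) / s ≤ c := (le_max_left _ _).trans (le_max_right _ _)
  have hcb : c⁻¹ ≤ b := inv_le_of_inv_le₀ hb0 ((le_max_right _ _).trans (le_max_right _ _))
  have hfa' : (0 : ℝ) < f a := by exact_mod_cast hfa
  refine ⟨c, by linarith, min (f a) (r₀ / 6), lt_min hfa' (by positivity),
    fun δ hδ hδ₀ => ?_⟩
  have hδa : δ < f a := hδ₀.trans_le (min_le_left _ _)
  have hδr : δ < r₀ / 6 := hδ₀.trans_le (min_le_right _ _)
  have hfT : f (Function.invFun f δ.toNNReal) = δ.toNNReal :=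
    Function.invFun_eq (InvariantMetrics.existsUnique_preimage hf hf0 hfne hmono
      (Real.toNNReal_pos.2 hδ)).exists
  set T := Function.invFun f δ.toNNReal with hT
  have hfT' : (f T : ℝ) = δ := by rw [hfT, Real.coe_toNNReal _ hδ.le]
  have hT0 : 0 < T := by
    rcases eq_or_ne T 0 with h | h
    · rw [h, hf0] at hfT'
      exact absurd hfT' hδ.ne
    · exact pos_iff_ne_zero.2 h
  have hT0' : (0 : ℝ) < T := by exact_mod_cast hT0
  have hlin : ∀ x : ℝ≥0, (T : ℝ) ≤ x → δ * x ≤ f x * T := fun x hx => by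
    rw [← hfT']
    exact_mod_cast InvariantMetrics.mul_le_mul_of_monotoneOn_div hmono hT0 (by exact_mod_cast hx)
  have hTle : ∀ x : ℝ≥0, δ < f x → (T : ℝ) ≤ x := fun x hx => by
    rw [← hfT'] at hx
    exact_mod_cast InvariantMetrics.le_of_apply_lt_apply hf0 hmono (by exact_mod_cast hx)
  have hTa : (T : ℝ) ≤ a := hTle a hδa
  have hδT : δ / T ≤ K := by
    rw [hK, div_le_div_iff₀ hT0' (by exact_mod_cast ha0)]
    exact hlin a hTa
  have hq : InvariantMetrics.basePoint m δ ∈ D := by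
    refine hin _ (by rw [InvariantMetrics.norm_basePoint hδ.le]; linarith) ?_
    simp [hf0, hδ]
  -- Truncation by `τ₀` ensures `τ ≤ exp (-1)` and covers points of `D` with `‖z‖ ≥ r₀`, where `δ <
  -- r₀/6` gives `‖tail z‖ ≥ r₀/2`. It costs only the factor `L`, as `T ≤ a`.
  set τ := min (T : ℝ) τ₀ with hτ
  have hτ0 : 0 < τ := lt_min hT0' hτ₀0
  have hTτ : T ≤ L * τ := by
    rcases le_total (T : ℝ) τ₀ with h1 | h1
    · rw [hτ, min_eq_left h1, hL]
      nlinarith [div_nonneg a.coe_nonneg hτ₀0.le]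
    · rw [hτ, min_eq_right h1, hL, add_mul, div_mul_cancel₀ _ hτ₀0.ne']
      linarith
  have hgap : ∀ z ∈ D, ‖z 0 - 2 * (δ : ℂ)‖ < κ * δ → τ ≤ ‖InvariantMetrics.tail z‖ := by
    intro z hzD hz
    rcases lt_or_ge ‖z‖ r₀ with h1 | h1
    · refine (min_le_left _ _).trans (hTle ‖InvariantMetrics.tail z‖₊ ?_)
      have h2 := hout z hzD h1
      have h3 : |(z 0).re - 2 * δ| ≤ ‖z 0 - 2 * (δ : ℂ)‖ := by
        simpa using (z 0 - 2 * (δ : ℂ)).abs_re_le_norm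
      have h4 : |(z 0).im| ≤ ‖z 0 - 2 * (δ : ℂ)‖ := by
        simpa using (z 0 - 2 * (δ : ℂ)).abs_im_le_norm
      have h5 := neg_le_of_abs_le h3
      have h6 : (1 + C) * ‖z 0 - 2 * (δ : ℂ)‖ < δ := by
        calc (1 + C) * ‖z 0 - 2 * (δ : ℂ)‖ < (1 + C) * (κ * δ) := by gcongr
          _ = δ := by rw [hκ]; field_simp
      have h7 := mul_le_mul_of_nonneg_left h4 hC.le
      linarith
    · refine (min_le_right _ _).trans ((min_le_left _ _).trans ?_)
      have h2 := InvariantMetrics.norm_le_head_add_tail z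
      have h3 : ‖z 0‖ ≤ ‖z 0 - 2 * (δ : ℂ)‖ + 2 * δ := by
        calc ‖z 0‖ = ‖(z 0 - 2 * (δ : ℂ)) + ((2 * δ : ℝ) : ℂ)‖ := by push_cast; ring_nf
          _ ≤ _ := (norm_add_le _ _).trans (by
            rw [Complex.norm_real, Real.norm_of_nonneg (by positivity)])
      have h4 : κ * δ ≤ δ := mul_le_of_le_one_left hδ.le hκ1
      linarith
  refine ⟨hq, fun X => ⟨?_, InvariantMetrics.sibonyMetric_le_azukawaMetric hDopen hq X, ?_⟩⟩
  · have h1 := InvariantMetrics.ofReal_norm_div_le_sibonyMetric hDopen hq (R := 2 * R + 1)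
      (by linarith)
      (fun w hw => by
        linarith [norm_sub_le w (InvariantMetrics.basePoint m δ), hDR w hw, hDR _ hq]) X
    have h2 := InvariantMetrics.ofReal_le_sibonyMetric_basePoint hDopen hδ hq hτ0
      ((min_le_right _ _).trans (min_le_right _ _)) hκ0 hκ1 hR1 hDR hgap X
    refine le_trans ?_ (max_le h2 h1)
    rw [← ENNReal.ofReal_max]
    refine ENNReal.ofReal_le_ofReal ?_
    have h3 : c⁻¹ * (T / δ * ‖X 0‖) ≤ k * (τ / δ * ‖X 0‖) / 2 := by
      calc c⁻¹ * (T / δ * ‖X 0‖) ≤ k / (2 * L) * (L * τ / δ * ‖X 0‖) := by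
            gcongr
            exact hcb.trans (min_le_left _ _)
        _ = _ := by field_simp
    have h4 : c⁻¹ * ‖X‖ ≤ ‖X‖ / (2 * R + 1) / 2 := by
      calc c⁻¹ * ‖X‖ ≤ 1 / (2 * (2 * R + 1)) * ‖X‖ := by
            gcongr
            exact hcb.trans (min_le_right _ _)
        _ = _ := by field_simp
    rw [InvariantMetrics.modelB, mul_add]
    linarith [le_max_left (k * (τ / δ * ‖X 0‖)) (‖X‖ / (2 * R + 1)),
      le_max_right (k * (τ / δ * ‖X 0‖)) (‖X‖ / (2 * R + 1))]
  · have hr : δ + s * (δ / T + 1) < r₀ := by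
      have h1 : s * (δ / T + 1) ≤ s * (K + 1) := by gcongr
      have h2 : s * (K + 1) = r₀ / 2 := by rw [hs]; field_simp
      linarith
    refine (InvariantMetrics.azukawaMetric_le_of_profile hm hDopen hC.le hin hδ hT0' hs0 hr
      hlin X).trans
      (ENNReal.ofReal_le_ofReal ?_)
    exact mul_le_mul_of_nonneg_right hcs (by positivity)
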